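/- All graphs are simple, possibly infinite, and connected graphs are non-empty. A *ray* is a one-way infinite path; a graph is *rayless* if it contains no ray. An *end* of $G$ is an equivalence class of rays of $G$, where two rays are equivalent if for every finite $X\subseteq V(G)$ they have tails in the same component of $G-X$. For $X\subseteq V(G)$ let $\mathcal C_X$ be the set of components of $G-X$ and $\breve{\mathcal C}_X:=\{C\in\mathcal C_X: N(C)=X\}$. A finite set $X\subseteq V(G)$ is *critical* if $\breve{\mathcal C}_X$ is infinite. The *combinatorial remainder* $\Gamma(G)=\Omega(G)\sqcup\mathrm{crit}(G)$ is the disjoint union of the set of ends and the set of critical vertex sets of $G$. *Rank.* Finite graphs have rank $0$. For an ordinal $\rho>0$, a graph $G$ has rank $\rho$ if it has no rank $\beta<\rho$ and there is a finite $X\subseteq V(G)$ such that every component of $G-X$ has some rank $<\rho$. *Separations.* For $X\subseteq V(G)$ and $\mathcal C\subseteq\mathcal C_X$ put $V[\mathcal C]=\bigcup_{C\in\mathcal C}V(C)$, $(X,\mathcal C)=(V(G)\setminus V[\mathcal C],\,X\cup V[\mathcal C])$ and $(\mathcal C,X)=(X\cup V[\mathcal C],\,V(G)\setminus V[\mathcal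 C])$; write $(C,X)$ for $(\{C\},X)$. For finite $X$ this separation is *tame* if for no $Y\subseteq X$ both $\mathcal C$ and $\mathcal C_X\setminus\mathcal C$ contain infinitely many components with neighbourhood exactly $Y$. An end *orients* a separation $\{A,B\}$ towards $B$ if each of its rays has a tail in $B$; a critical vertex set $X$ does so if $X\subseteq B$ and all but finitely many $C\in\breve{\mathcal C}_X$ satisfy $V(C)\subseteq B$. *Tree-decompositions.* Let $(T,(V_t)_{t\in T})$ be a tree-decomposition of $G$, with $T$ rooted. For an edge $st$ of $T$ let $\alpha(s,t)=(A,B)$, where $A$ and $B$ are the unions of the parts at the nodes of the component of $T-st$ containing $s$ and $t$, respectively. The tree-decomposition is *tame* if every $\alpha(s,t)$ is a tame finite-order separation. Then each $\gamma\in\Gamma(G)$ orients every edge of $T$, and this defines a map $\sigma:\Gamma(G)\to\Omega(T)\sqcup V(T)$: put $\sigma(\gamma)=t$ if $\gamma$ orients every edge $st$ at $t$ towards $t$ (that is, orients $\alpha(s,t)=(A,B)$ towards $B$), and $\sigma(\gamma)=\eta\in\Omega(T)$ if for some ray $t_0t_1\dots$ in $\eta$ it orients every edge $t_nt_{n+1}$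 towards $t_{n+1}$. A rooted tame tree-decomposition *displays* $\Gamma(G)$ if - $\sigma$ restricts to a bijection between $\Omega(G)$ and $\Omega(T)$; and - $\sigma$ restricts to a bijection between $\mathrm{crit}(G)$ and the set of infinite-degree nodes of $T$ such that whenever $\sigma(X)=t$ for a critical vertex set $X$, then $t$ has a predecessor $s$ in the rooted tree $T$ with $\alpha(s,t)=(X,\mathcal C)$ for some $\mathcal C\subseteq\breve{\mathcal C}_X$ with $\breve{\mathcal C}_X\setminus\mathcal C$ finite, and $s'\mapsto\alpha(s',t)$ is a bijection from the neighbours of $t$ in $T$ to the set consisting of $(X,\mathcal C)$ and all $(C,X)$ with $C\in\mathcal C$. **Corollary 3.12.** Let $G$ be a connected graph. Then $G$ is rayless if and only if $G$ has a rank. If $G$ is rayless, then $G$ has a rooted tame tree-decomposition $(T,(V_t)_{t\in T})$ into finite parts that displays the combinatorial remainder $\Gamma(G)$ of $G$ and whose decomposition tree $T$ has a rank, equal to the rank of $G$. -/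

import Mathlib

universe u

namespace InfGraph

open SimpleGraph

/-! ### Rays and ends -/

/-- A ray: a one-way infinite path `v₀ v₁ v₂ …` with pairwise distinct vertices. -/
structure Ray {V : Type u} (G : SimpleGraph V) where
  vert : ℕ → V
  inj : Function.Injective vert
  adj : ∀ n, G.Adj (vert n) (vert (n + 1))

/-- A graph is rayless if it contains no ray. -/
def IsRayless {V : Type u} (G : SimpleGraph V) : Prop := IsEmpty (Ray G)

/-- The ray `R` has a tail inside the vertex set `S`. -/
def Ray.HasTailIn {V : Type u} {G : SimpleGraph V} (R : Ray G) (S : Set V) : Prop :=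
  ∃ N, ∀ n, N ≤ n → R.vert n ∈ S

/-- Two rays are equivalent if for every finite vertex set `X` both have a tail in the same
component of `G - X`. (`G.ComponentCompl X` is Mathlib's type of components of `G - X`.) -/
def Ray.Equivalent {V : Type u} {G : SimpleGraph V} (R R' : Ray G) : Prop :=
  ∀ X : Set V, X.Finite →
    ∃ C : G.ComponentCompl X, R.HasTailIn (C : Set V) ∧ R'.HasTailIn (C : Set V)

theorem Ray.exists_tail {V : Type u} {G : SimpleGraph V} (R : Ray G) {X : Set V}
    (hX : X.Finite) : ∃ C : G.ComponentCompl X, R.HasTailIn (C : Set V) := by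
  have hfin : (R.vert ⁻¹' X).Finite := hX.preimage R.inj.injOn
  obtain ⟨N, hN⟩ := hfin.bddAbove
  have hout : ∀ n, N + 1 ≤ n → R.vert n ∉ X := fun n hn h => by
    have : n ≤ N := hN h
    omega
  refine ⟨G.componentComplMk (hout (N + 1) le_rfl), N + 1, fun n hn => ?_⟩
  induction n, hn using Nat.le_induction with
  | base => exact G.componentComplMk_mem _
  | succ n hn ih =>
    exact ComponentCompl.mem_of_adj _ _ ih (hout (n + 1) (by omega)) (R.adj n)

theorem Ray.equivalent_equivalence {V : Type u} (G : SimpleGraph V) :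
    Equivalence (Ray.Equivalent (G := G)) where
  refl R X hX := by
    obtain ⟨C, hC⟩ := R.exists_tail hX
    exact ⟨C, hC, hC⟩
  symm h X hX := by
    obtain ⟨C, h1, h2⟩ := h X hX
    exact ⟨C, h2, h1⟩
  trans {R R' R''} h h' X hX := by
    obtain ⟨C, h1, N, hN⟩ := h X hX
    obtain ⟨D, ⟨M, hM⟩, h4⟩ := h' X hX
    have hCD : C = D := by
      by_contra hne
      exact (Set.disjoint_left.mp (ComponentCompl.pairwise_disjoint hne))
        (hN (max N M) (le_max_left _ _)) (hM (max N M) (le_max_right _ _))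
    subst hCD
    exact ⟨C, h1, h4⟩

/-- The setoid of rays under equivalence. -/
instance raySetoid {V : Type u} (G : SimpleGraph V) : Setoid (Ray G) :=
  ⟨Ray.Equivalent, Ray.equivalent_equivalence G⟩

/-- The ends of `G`: equivalence classes of rays. -/
def GraphEnd {V : Type u} (G : SimpleGraph V) : Type u := Quotient (raySetoid G)

/-! ### Critical vertex sets and the combinatorial remainder -/

/-- The neighbourhood of a vertex set `S`: the vertices outside `S` with a neighbour in `S`. -/
def nbhd {V : Type u} (G : SimpleGraph V) (S : Set V) : Set V :=
  {v | v ∉ S ∧ ∃ w ∈ S, G.Adj w v}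

/-- The components `C` of `G - X` with `N(C) = Y`. -/
def compsWithNbhd {V : Type u} (G : SimpleGraph V) (X Y : Set V) : Set (G.ComponentCompl X) :=
  {C | nbhd G (C : Set V) = Y}

/-- The critical vertex sets of `G`: the finite vertex sets `X` such that infinitely many
components of `G - X` have neighbourhood precisely `X`. -/
def crit {V : Type u} (G : SimpleGraph V) : Set (Set V) :=
  {X | X.Finite ∧ (compsWithNbhd G X X).Infinite}

/-- The combinatorial remainder of `G`: the disjoint union of its ends and its critical
vertex sets. -/
abbrev Remainder {V : Type u} (G : SimpleGraph V) : Type u := GraphEnd G ⊕ crit G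

/-! ### Separations -/

/-- `V[𝒞]`, the union of the vertex sets of the components in `𝒞`. -/
def compsUnion {V : Type u} {G : SimpleGraph V} {X : Set V} (𝒞 : Set (G.ComponentCompl X)) :
    Set V :=
  ⋃ C ∈ 𝒞, (C : Set V)

/-- The oriented separation `(X, 𝒞) = (V ∖ V[𝒞], X ∪ V[𝒞])`. Its inverse `(𝒞, X)` is obtained
with `Prod.swap`. -/
def orientedSep {V : Type u} {G : SimpleGraph V} (X : Set V) (𝒞 : Set (G.ComponentCompl X)) :
    Set V × Set V :=
  ((compsUnion 𝒞)ᶜ, X ∪ compsUnion 𝒞)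

/-- The pair of vertex sets `P` is a finite-order separation `{X, 𝒞}` of `G` (in one of its
orientations) that is tame: for no `Y ⊆ X` do both `𝒞` and its complement in the set of
components of `G - X` contain infinitely many components with neighbourhood precisely `Y`. -/
def IsTameSep {V : Type u} (G : SimpleGraph V) (P : Set V × Set V) : Prop :=
  ∃ (X : Set V) (𝒞 : Set (G.ComponentCompl X)), X.Finite ∧ P = orientedSep X 𝒞 ∧
    ∀ Y ⊆ X, ¬ ((𝒞 ∩ compsWithNbhd G X Y).Infinite ∧ (𝒞ᶜ ∩ compsWithNbhd G X Y).Infinite)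

/-- The element `γ` of the combinatorial remainder orients the separation `{P.1, P.2}` towards
the side `P.2`. An end does so if each of its rays has a tail in `P.2`; a critical vertex set `X`
does so if `P.2` contains `X` and all but finitely many of the components of `G - X` with
neighbourhood `X`. -/
def OrientsTowards {V : Type u} {G : SimpleGraph V} (γ : Remainder G) (P : Set V × Set V) : Prop :=
  match γ with
  | Sum.inl ω => ∀ R : Ray G, (Quotient.mk (raySetoid G) R : GraphEnd G) = ω → R.HasTailIn P.2
  | Sum.inr X => (X : Set V) ⊆ P.2 ∧
      {C ∈ compsWithNbhd G (X : Set V) (X : Set V) | ¬ (C : Set V) ⊆ P.2}.Finite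

/-! ### Tree-decompositions -/

/-- A tree-decomposition of `G` with decomposition tree on the node set `W`. -/
structure TreeDecomposition {V : Type u} (G : SimpleGraph V) (W : Type u) where
  tree : SimpleGraph W
  isTree : tree.IsTree
  part : W → Set V
  /-- Every vertex lies in some part. -/
  vertex_mem : ∀ v, ∃ t, v ∈ part t
  /-- Every edge has both its ends in some part. -/
  edge_mem : ∀ v w, G.Adj v w → ∃ t, v ∈ part t ∧ w ∈ part t
  /-- `V_{t₁} ∩ V_{t₃} ⊆ V_{t₂}` whenever `t₂` lies on the path in the tree from `t₁` to `t₃`. -/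
  inter_subset : ∀ (t₁ t₂ t₃ : W) (p : tree.Walk t₁ t₃), p.IsPath → t₂ ∈ p.support →
    part t₁ ∩ part t₃ ⊆ part t₂

namespace TreeDecomposition

variable {V : Type u} {G : SimpleGraph V} {W : Type u} (D : TreeDecomposition G W)

/-- For an edge `st` of the tree: the nodes of the component of `T - st` containing `s`. -/
def side (s t : W) : Set W := {x | (D.tree.deleteEdges {s(s, t)}).Reachable s x}

/-- For an edge `st` of the tree: the oriented separation `α(s, t)` of `G` that it induces, i.e.
the pair of the union of the parts on the side of `s` and the union of the parts on the side
of `t`. -/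
def sep (s t : W) : Set V × Set V :=
  (⋃ x ∈ D.side s t, D.part x, ⋃ x ∈ D.side t s, D.part x)

/-- A tree-decomposition is tame if all the separations that it induces are tame finite-order
separations. -/
def IsTame : Prop := ∀ s t, D.tree.Adj s t → IsTameSep G (D.sep s t)

/-- `γ` lives at the node `t`: it orients all the edges of the tree at `t` towards `t`. -/
def LivesAt (γ : Remainder G) (t : W) : Prop :=
  ∀ s, D.tree.Adj s t → OrientsTowards γ (D.sep s t)

/-- `γ` corresponds to the end `η` of the tree: for some ray `t₀ t₁ …` in `η`, it orients all the
edges `tₙ tₙ₊₁` from `tₙ` towards `tₙ₊₁`. -/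
def CorrespondsTo (γ : Remainder G) (η : GraphEnd D.tree) : Prop :=
  ∃ R : Ray D.tree, (Quotient.mk (raySetoid D.tree) R : GraphEnd D.tree) = η ∧
    ∀ n, OrientsTowards γ (D.sep (R.vert n) (R.vert (n + 1)))

/-- `σ` is the map from the combinatorial remainder of `G` to the disjoint union of the ends
and the nodes of the tree that sends each `γ` to the unique end or node that it corresponds to
or lives at, respectively. -/
def IsSigma (σ : Remainder G → GraphEnd D.tree ⊕ W) : Prop :=
  ∀ γ, (∀ η, σ γ = Sum.inl η ↔ D.CorrespondsTo γ η) ∧ (∀ t, σ γ = Sum.inr t ↔ D.LivesAt γ t)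

/-- In the tree rooted at `r`, the node `s` is the predecessor of `t`: they are adjacent and `s`
lies on the path from `r` to `t`. -/
def IsPredecessor (r s t : W) : Prop :=
  D.tree.Adj s t ∧ ∀ p : D.tree.Walk r t, p.IsPath → s ∈ p.support

/-- The tree-decomposition `D`, with its tree rooted at `r`, displays the subset `Ψ` of the
combinatorial remainder of `G`. (Meant for tame `D`.) The oriented edges `(s, t)` of the tree
into a node `t` are indexed by the neighbours `s` of `t`. -/
def Displays (r : W) (Ψ : Set (Remainder G)) : Prop :=
  ∃ σ : Remainder G → GraphEnd D.tree ⊕ W, D.IsSigma σ ∧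
    Set.BijOn σ (Ψ ∩ Set.range Sum.inl) (Set.range Sum.inl) ∧
    Set.BijOn σ (Ψ ∩ Set.range Sum.inr) (Sum.inr '' {t | (D.tree.neighborSet t).Infinite}) ∧
    (∀ (X : crit G) (t : W), Sum.inr X ∈ Ψ → σ (Sum.inr X) = Sum.inr t →
      ∃ (s : W) (𝒞 : Set (G.ComponentCompl (X : Set V))), D.IsPredecessor r s t ∧
        D.sep s t = orientedSep (X : Set V) 𝒞 ∧
        𝒞 ⊆ compsWithNbhd G (X : Set V) (X : Set V) ∧
        (compsWithNbhd G (X : Set V) (X : Set V) \ 𝒞).Finite ∧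
        Set.BijOn (fun s' => D.sep s' t) (D.tree.neighborSet t)
          (insert (orientedSep (X : Set V) 𝒞)
            {P | ∃ C ∈ 𝒞, P = (orientedSep (X : Set V) {C}).swap})) ∧
    ∀ γ, γ ∉ Ψ → ∃ t, σ γ = Sum.inr t ∧ (D.tree.neighborSet t).Finite

end TreeDecomposition

/-! ### The Schmidt rank -/

/-- `HasRank ρ G`: the graph `G` has (Schmidt) rank `ρ`. Finite graphs have rank `0`; for `ρ > 0`
the graph `G` has rank `ρ` if it does not already have a rank `< ρ` and there is a finite set `X`
of vertices such that every component of `G - X` has some rank `< ρ`. -/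
def HasRank (ρ : Ordinal.{u}) {V : Type u} (G : SimpleGraph V) : Prop :=
  (ρ = 0 ∧ Finite V) ∨
  (0 < ρ ∧ (∀ β, ∀ _ : β < ρ, ¬ HasRank β G) ∧
    ∃ X : Set V, X.Finite ∧ ∀ C : G.ComponentCompl X,
      ∃ β, ∃ _ : β < ρ, HasRank β (G.induce (C : Set V)))
termination_by ρ

end InfGraph

/-!
A graph that has a rank `ρ` also has a normal tree of rank at most `ρ`: a rooted tree on its vertex
set in which adjacent vertices are comparable and every up-set of a vertex other than the root is
connected. It is grown from the finite set that witnesses the rank, one vertex at a time. In a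
normal tree the neighbourhood of the up-set of a vertex `k` lies below `k`, and for a finite set `Y`
all but finitely many components of `G - Y` are such up-sets. So `Y` is critical exactly if
infinitely many up-sets have neighbourhood `Y`, and all those vertices `k` have the same parent.
Inserting every critical set `Y` as a new node between this parent and the vertices `k` turns the
normal tree into the desired decomposition tree. Its rank is not less than that of `G` because its
parts are finite, and not greater than that of the normal tree because it contracts onto the normal
tree with finite fibres.
-/

namespace InfGraph

open SimpleGraph

/-! ### Connected vertex sets -/

section Connectivity

variable {V W : Type*} {G : SimpleGraph V} {H : SimpleGraph W} {X D : Set V}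

theorem mem_of_reachable {A : Set V} (hA : ∀ a ∈ A, ∀ b, G.Adj a b → b ∈ A) {a b : V}
    (h : G.Reachable a b) (ha : a ∈ A) : b ∈ A := by
  obtain ⟨p⟩ := h
  induction p with
  | nil => exact ha
  | cons hadj _ ih => exact ih (hA _ ha _ hadj)

theorem subset_of_connected_induce {A : Set V} (hD : (G.induce D).Connected)
    (h : (D ∩ A).Nonempty) (hA : ∀ a ∈ D ∩ A, ∀ b ∈ D, G.Adj a b → b ∈ A) : D ⊆ A := by
  obtain ⟨a, haD, haA⟩ := h
  intro b hb
  exact mem_of_reachable (A := {x : D | (x : V) ∈ A})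
    (fun x hx y hxy => hA x ⟨x.2, hx⟩ y y.2 hxy) (hD.preconnected ⟨a, haD⟩ ⟨b, hb⟩) haA

theorem connected_induce_setOf_eq (v : V) : (G.induce {w | v = w}).Connected :=
  connected_iff_exists_forall_reachable _ |>.mpr ⟨⟨v, rfl⟩, fun ⟨_, h⟩ => by cases h; rfl⟩

theorem connected_induce_image (f : H →g G) {S : Set W} (hS : (H.induce S).Connected) :
    (G.induce (f '' S)).Connected :=
  hS.map (induceHom f (Set.mapsTo_image f S)) fun ⟨_, w, hw, h⟩ => ⟨⟨w, hw⟩, Subtype.ext h⟩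

theorem connected_induce_componentCompl (C : G.ComponentCompl X) :
    (G.induce (C : Set V)).Connected := by
  let f : (ConnectedComponent.toSimpleGraph C) →g G.induce (C : Set V) :=
    ⟨fun x => ⟨x.1.1, x.1.2, x.2⟩, fun h => h⟩
  exact (ConnectedComponent.connected_toSimpleGraph C).map f fun ⟨_, hvX, hv⟩ =>
    ⟨⟨⟨_, hvX⟩, hv⟩, rfl⟩

theorem componentCompl_eq_of_mem {C C' : G.ComponentCompl X} {v : V} (hv : v ∈ C)
    (hv' : v ∈ C') : C = C' := by
  by_contra hne
  exact Set.disjoint_left.mp (ComponentCompl.pairwise_disjoint hne) hv hv'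

theorem finite_componentCompl_meeting {Z : Set V} (hZ : Z.Finite) :
    {C : G.ComponentCompl X | ((C : Set V) ∩ Z).Nonempty}.Finite := by
  refine (hZ.biUnion (t := fun z => {C : G.ComponentCompl X | z ∈ (C : Set V)}) fun z _ =>
    Set.Subsingleton.finite fun C hC C' hC' => componentCompl_eq_of_mem hC hC').subset ?_
  rintro C ⟨z, hz, hzZ⟩
  exact Set.mem_biUnion hzZ hz

theorem exists_componentCompl_of_hom (hH : H.Connected) (f : H →g G) (hf : ∀ w, f w ∉ X) :
    ∃ C : G.ComponentCompl X, ∀ w, f w ∈ C := by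
  obtain ⟨w₀⟩ := hH.nonempty
  refine ⟨G.componentComplMk (hf w₀), fun w => ?_⟩
  exact mem_of_reachable (A := {x | f x ∈ G.componentComplMk (hf w₀)})
    (fun x hx y hxy => ComponentCompl.mem_of_adj _ _ hx (hf y) (f.map_adj hxy))
    (hH.preconnected w₀ w) (G.componentComplMk_mem _)

theorem exists_componentCompl_nbhd (hD : (G.induce D).Connected) :
    ∃ C : G.ComponentCompl (nbhd G D), (C : Set V) = D := by
  obtain ⟨C, hC⟩ := exists_componentCompl_of_hom (X := nbhd G D) hD
    (Embedding.induce (G := G) D).toHom fun v hv => hv.1 v.2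
  obtain ⟨⟨v, hv⟩⟩ := hD.nonempty
  refine ⟨C, (subset_of_connected_induce (connected_induce_componentCompl C)
    ⟨v, hC ⟨v, hv⟩, hv⟩ ?_).antisymm fun w hw => hC ⟨w, hw⟩⟩
  intro a ha b hb hab
  by_contra hbD
  exact ComponentCompl.notMem_of_mem hb ⟨hbD, a, ha.2, hab⟩

end Connectivity

/-! ### The rank -/

section Rank

variable {V W : Type u} {G : SimpleGraph V} {H : SimpleGraph W} {ρ σ : Ordinal.{u}}

/-- `G` has a rank that is at most `ρ`. -/
def RankLE (ρ : Ordinal.{u}) (G : SimpleGraph V) : Prop := ∃ β ≤ ρ, HasRank β G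

/-- The vertex set `X` *reduces* `G` below `ρ`: it is finite and every component of `G - X` has a
rank less than `ρ`. -/
def Reduces (ρ : Ordinal.{u}) (G : SimpleGraph V) (X : Set V) : Prop :=
  X.Finite ∧ ∀ C : G.ComponentCompl X, ∃ β < ρ, RankLE β (G.induce (C : Set V))

theorem RankLE.mono (h : RankLE ρ G) (hσ : ρ ≤ σ) : RankLE σ G := by
  obtain ⟨β, hβ, h⟩ := h
  exact ⟨β, hβ.trans hσ, h⟩

theorem HasRank.le (h : HasRank ρ G) (h' : HasRank σ G) : ρ ≤ σ := by
  by_contra! hlt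
  rw [HasRank] at h
  rcases h with ⟨rfl, -⟩ | ⟨-, h, -⟩
  · exact not_lt_zero hlt
  · exact h σ hlt h'

theorem rankLE_iff_exists_reduces : RankLE ρ G ↔ ∃ X, Reduces ρ G X := by
  constructor
  · rintro ⟨β, hβ, h⟩
    rw [HasRank] at h
    rcases h with ⟨rfl, h⟩ | ⟨-, -, X, hX, h⟩
    · refine ⟨Set.univ, Set.finite_univ, fun C => ?_⟩
      obtain ⟨v, hv⟩ := C.nonempty
      exact absurd trivial (ComponentCompl.notMem_of_mem hv)
    · refine ⟨X, hX, fun C => ?_⟩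
      obtain ⟨γ, hγ, h⟩ := h C
      exact ⟨γ, hγ.trans_le hβ, γ, le_rfl, h⟩
  · rintro ⟨X, hX, h⟩
    by_cases hlt : ∃ β < ρ, HasRank β G
    · obtain ⟨β, hβ, h⟩ := hlt
      exact ⟨β, hβ.le, h⟩
    push Not at hlt
    refine ⟨ρ, le_rfl, ?_⟩
    rw [HasRank]
    rcases eq_or_ne ρ 0 with rfl | hρ
    · refine Or.inl ⟨rfl, Set.finite_univ_iff.mp (hX.subset fun v _ => ?_)⟩
      by_contra hv
      obtain ⟨β, hβ, -⟩ := h (G.componentComplMk hv)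
      exact not_lt_zero hβ
    · refine Or.inr ⟨pos_iff_ne_zero.mpr hρ, fun β hβ => hlt β hβ, X, hX, fun C => ?_⟩
      obtain ⟨β, hβ, γ, hγ, h⟩ := h C
      exact ⟨γ, hγ.trans_lt hβ, h⟩

/-- If `H` is decomposed into finite parts modelled on `G`, then a set `X` that reduces `G` yields
the union of the parts at `X`, which reduces `H`. -/
theorem RankLE.of_finite_parts (h : RankLE ρ G) (part : V → Set W) (hfin : ∀ t, (part t).Finite)
    (hconn : ∀ w, (G.induce {t | w ∈ part t}).Connected)
    (hadj : ∀ w w', H.Adj w w' → ∃ s t, w ∈ part s ∧ w' ∈ part t ∧ (s = t ∨ G.Adj s t)) :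
    RankLE ρ H := by
  induction ρ using WellFoundedLT.induction generalizing V W with
  | ind ρ ih =>
  obtain ⟨X, hX, h⟩ := rankLE_iff_exists_reduces.mp h
  refine rankLE_iff_exists_reduces.mpr
    ⟨⋃ t ∈ X, part t, hX.biUnion fun t _ => hfin t, fun C => ?_⟩
  have havoid {w t} (hw : w ∈ C) (ht : w ∈ part t) : t ∉ X := fun htX =>
    ComponentCompl.notMem_of_mem hw (Set.mem_biUnion htX ht)
  obtain ⟨w₀, hw₀⟩ := C.nonempty
  obtain ⟨K, hK⟩ := exists_componentCompl_of_hom (X := X) (hconn w₀)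
    (Embedding.induce (G := G) _).toHom fun t => havoid hw₀ t.2
  have hCK : (C : Set W) ⊆ {w | ∀ t, w ∈ part t → t ∈ K} := by
    refine subset_of_connected_induce (connected_induce_componentCompl C)
      ⟨w₀, hw₀, fun t ht => hK ⟨t, ht⟩⟩ ?_
    rintro w ⟨-, hwK⟩ w' hw' hww'
    obtain ⟨s, t, hs, ht, hst⟩ := hadj w w' hww'
    have htK : t ∈ K := by
      rcases hst with rfl | hst
      · exact hwK s hs
      · exact ComponentCompl.mem_of_adj s t (hwK s hs) (havoid hw' ht) hst
    exact subset_of_connected_induce (hconn w') ⟨t, ht, htK⟩ fun a ha b hb hab =>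
      ComponentCompl.mem_of_adj a b ha.2 (havoid hw' hb) hab
  obtain ⟨β, hβ, hr⟩ := h K
  refine ⟨β, hβ, ih β hβ hr (fun t => {w | (w : W) ∈ part t})
    (fun t => (hfin t).preimage Subtype.val_injective.injOn) (fun w => ?_) fun w w' hww' => ?_⟩
  · exact (hconn w).map (G := G.induce {t | (w : W) ∈ part t})
      (H := (G.induce (K : Set V)).induce {t : (K : Set V) | (w : W) ∈ part t})
      ⟨fun t => ⟨⟨t, hCK w.2 t t.2⟩, t.2⟩, fun h => h⟩ fun t => ⟨⟨t, t.2⟩, rfl⟩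
  · obtain ⟨s, t, hs, ht, hst⟩ := hadj w w' hww'
    exact ⟨⟨s, hCK w.2 s hs⟩, ⟨t, hCK w'.2 t ht⟩, hs, ht, hst.imp Subtype.ext id⟩

theorem RankLE.of_hom (h : RankLE ρ G) (f : H →g G) (hf : Function.Injective f) :
    RankLE ρ H :=
  h.of_finite_parts (fun v => f ⁻¹' {v}) (fun v => (Set.finite_singleton v).preimage
    hf.injOn) (fun w => connected_induce_setOf_eq (f w))
    fun w w' hww' => ⟨f w, f w', rfl, rfl, Or.inr (f.map_adj hww')⟩

theorem Reduces.exists_lt_rankLE {X : Set V} (h : Reduces ρ G X) (hH : H.Connected)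
    (f : H →g G) (hf : Function.Injective f) (hfX : ∀ w, f w ∉ X) : ∃ β < ρ, RankLE β H := by
  obtain ⟨C, hC⟩ := exists_componentCompl_of_hom hH f hfX
  obtain ⟨β, hβ, hr⟩ := h.2 C
  exact ⟨β, hβ, hr.of_hom (H := H) ⟨fun w => ⟨f w, hC w⟩, f.map_adj⟩ fun _ _ heq =>
    hf (congrArg Subtype.val heq)⟩

/-- A reducing set of `G` is obtained from `X` by adding reducing sets of the finitely many
exceptional graphs `G[S i]`. -/
theorem RankLE.of_cover {ι : Type*} {X : Set V} (hX : X.Finite) (S : ι → Set V)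
    (hcov : ∀ v ∉ X, ∃ i, v ∈ S i) (hclosed : ∀ i, ∀ a ∈ S i, ∀ b ∉ X, G.Adj a b → b ∈ S i)
    {F : Set ι} (hF : F.Finite) (hrank : ∀ i ∈ F, RankLE ρ (G.induce (S i)))
    (hlt : ∀ i ∉ F, ∃ β < ρ, RankLE β (G.induce (S i))) : RankLE ρ G := by
  choose! Y hY using fun i hi => rankLE_iff_exists_reduces.mp (hrank i hi)
  refine rankLE_iff_exists_reduces.mpr ⟨X ∪ ⋃ i ∈ F, (↑) '' Y i,
    hX.union (hF.biUnion fun i hi => (hY i hi).1.image _), fun C => ?_⟩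
  have havoid {v} (hv : v ∈ C) : v ∉ X ∧ ∀ i ∈ F, ∀ y ∈ Y i, (y : V) ≠ v := by
    have := ComponentCompl.notMem_of_mem hv
    simp only [Set.mem_union, not_or, Set.mem_iUnion, not_exists] at this
    exact ⟨this.1, fun i hi y hy hyv => this.2 i hi ⟨y, hy, hyv⟩⟩
  obtain ⟨v, hv⟩ := C.nonempty
  obtain ⟨i, hi⟩ := hcov v (havoid hv).1
  have hCi : (C : Set V) ⊆ S i := subset_of_connected_induce (connected_induce_componentCompl C)
    ⟨v, hv, hi⟩ fun a ha b hb hab => hclosed i a ha.2 b (havoid hb).1 hab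
  by_cases hiF : i ∈ F
  · exact (hY i hiF).exists_lt_rankLE (connected_induce_componentCompl C)
      (G.induceHomOfLE hCi).toHom (G.induceHomOfLE hCi).injective
      fun w hw => (havoid w.2).2 i hiF _ hw rfl
  · obtain ⟨β, hβ, hr⟩ := hlt i hiF
    exact ⟨β, hβ, hr.of_hom (G.induceHomOfLE hCi).toHom (G.induceHomOfLE hCi).injective⟩

end Rank

/-! ### The graphs with a rank are the rayless graphs -/

section Rayless

variable {V : Type u} {G : SimpleGraph V} {ρ : Ordinal.{u}}

theorem RankLE.isRayless (h : RankLE ρ G) : IsRayless G := by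
  induction ρ using WellFoundedLT.induction generalizing V with
  | ind ρ ih =>
  obtain ⟨X, hX, h⟩ := rankLE_iff_exists_reduces.mp h
  refine ⟨fun R => ?_⟩
  obtain ⟨C, N, hN⟩ := R.exists_tail hX
  obtain ⟨β, hβ, hr⟩ := h C
  refine (ih β hβ hr).false ⟨fun n => ⟨R.vert (N + n), hN _ (Nat.le_add_right N n)⟩, ?_,
    fun n => R.adj (N + n)⟩
  intro m n hmn
  exact Nat.add_left_cancel (R.inj (congrArg Subtype.val hmn))

theorem exists_componentCompl_unranked {X : Set V} (hX : X.Finite) (hG : ¬ ∃ ρ, RankLE ρ G) :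
    ∃ C : G.ComponentCompl X, ¬ ∃ ρ, RankLE ρ (G.induce (C : Set V)) := by
  by_contra! hcon
  choose f hf using hcon
  exact hG ⟨Order.succ (⨆ C, f C), rankLE_iff_exists_reduces.mpr
    ⟨X, hX, fun C => ⟨f C, Order.lt_succ_of_le (Ordinal.le_iSup f C), hf C⟩⟩⟩

theorem exists_adj_unranked_subset {S : Set V} (hS : (G.induce S).Connected)
    (hr : ¬ ∃ ρ, RankLE ρ (G.induce S)) {v : V} (hv : v ∈ S) :
    ∃ D ⊆ S \ {v}, (G.induce D).Connected ∧ (¬ ∃ ρ, RankLE ρ (G.induce D)) ∧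
      ∃ w ∈ D, G.Adj v w := by
  obtain ⟨C, hC⟩ := exists_componentCompl_unranked (Set.finite_singleton (⟨v, hv⟩ : S)) hr
  let incl : G.induce S →g G := (Embedding.induce (G := G) S).toHom
  refine ⟨incl '' (C : Set S), ?_,
    connected_induce_image incl (connected_induce_componentCompl C), ?_, ?_⟩
  · rintro _ ⟨w, hw, rfl⟩
    exact ⟨w.2, fun h => ComponentCompl.notMem_of_mem hw (Subtype.ext h)⟩
  · rintro ⟨ρ, h⟩
    exact hC ⟨ρ, h.of_hom (induceHom incl (Set.mapsTo_image incl _))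
      (induceHom_injective _ _ Subtype.val_injective.injOn)⟩
  · obtain ⟨⟨a, _⟩, ha, rfl, hab⟩ :=
      C.exists_adj_boundary_pair hS.preconnected (Set.singleton_nonempty _)
    exact ⟨a, ⟨a, ha, rfl⟩, hab.symm⟩

theorem exists_rankLE_of_isRayless (h : IsRayless G) : ∃ ρ, RankLE ρ G := by
  by_contra hG
  -- a stage of the construction of a ray: where the ray continues, and its current vertex
  let Stage := {p : Set V × V //
    p.2 ∈ p.1 ∧ (G.induce p.1).Connected ∧ ¬ ∃ ρ, RankLE ρ (G.induce p.1)}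
  have hstep (p : Stage) : ∃ q : Stage, q.1.1 ⊆ p.1.1 \ {p.1.2} ∧ G.Adj p.1.2 q.1.2 := by
    obtain ⟨D, hDS, hD, hDr, w, hw, hvw⟩ := exists_adj_unranked_subset p.2.2.1 p.2.2.2 p.2.1
    exact ⟨⟨(D, w), hw, hD, hDr⟩, hDS, hvw⟩
  choose next hnext hadj using hstep
  obtain ⟨C, hC⟩ := exists_componentCompl_unranked Set.finite_empty hG
  obtain ⟨v₀, hv₀⟩ := C.nonempty
  let stage (n : ℕ) : Stage :=
    next^[n] ⟨((C : Set V), v₀), hv₀, connected_induce_componentCompl C, hC⟩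
  have hsucc (n : ℕ) : stage (n + 1) = next (stage n) := Function.iterate_succ_apply' _ _ _
  have hanti : Antitone fun n => (stage n).1.1 := antitone_nat_of_succ_le fun n => by
    rw [hsucc]
    exact (hnext _).trans Set.sdiff_subset
  have hne {m n : ℕ} (hmn : m < n) : (stage m).1.2 ≠ (stage n).1.2 := fun heq => by
    have hmem : (stage n).1.2 ∈ (stage (m + 1)).1.1 := hanti (Nat.succ_le_of_lt hmn) (stage n).2.1
    rw [hsucc, ← heq] at hmem
    exact (hnext _ hmem).2 rfl
  exact h.false ⟨fun n => (stage n).1.2, .of_lt_imp_ne fun _ _ => hne,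
    fun n => by rw [hsucc]; exact hadj _⟩

end Rayless

/-! ### Rooted trees given by a parent function -/

section RootedTree

variable {V : Type*} {p : V → V} {r a b c : V}

/-- The nodes above `a` (including `a`) in the tree with parent function `p`, that is, the nodes
from which iterating `p` leads to `a`. -/
def subtree (p : V → V) (a : V) : Set V := {b | ∃ n, p^[n] b = a}

/-- `p` is the parent function of a tree with root `r`, where the root is its own parent. -/
structure IsRootedTree (p : V → V) (r : V) : Prop where
  parent_root : p r = r
  mem_subtree_root : ∀ a, a ∈ subtree p r

/-- The graph in which every node is adjacent to its parent. -/
def parentGraph (p : V → V) : SimpleGraph V := fromRel fun a b => p a = b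

theorem self_mem_subtree (a : V) : a ∈ subtree p a := ⟨0, rfl⟩

theorem mem_subtree_of_parent_mem (h : p b ∈ subtree p a) : b ∈ subtree p a := by
  obtain ⟨n, h⟩ := h
  exact ⟨n + 1, h⟩

theorem mem_subtree_parent (a : V) : a ∈ subtree p (p a) := ⟨1, rfl⟩

theorem parent_mem_subtree (h : b ∈ subtree p a) (hne : b ≠ a) : p b ∈ subtree p a := by
  obtain ⟨_ | n, h⟩ := h
  · exact absurd h hne
  · exact ⟨n, h⟩

theorem subtree_subset (h : b ∈ subtree p a) : subtree p b ⊆ subtree p a := by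
  rintro c ⟨m, rfl⟩
  obtain ⟨n, rfl⟩ := h
  exact ⟨n + m, Function.iterate_add_apply p n m c⟩

theorem mem_subtree_total (ha : c ∈ subtree p a) (hb : c ∈ subtree p b) :
    a ∈ subtree p b ∨ b ∈ subtree p a := by
  obtain ⟨m, rfl⟩ := ha
  obtain ⟨n, rfl⟩ := hb
  rcases le_total m n with h | h
  · exact Or.inl ⟨n - m, by rw [← Function.iterate_add_apply, Nat.sub_add_cancel h]⟩
  · exact Or.inr ⟨m - n, by rw [← Function.iterate_add_apply, Nat.sub_add_cancel h]⟩

theorem subtree_induction {motive : V → Prop} (top : motive a)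
    (step : ∀ b ∈ subtree p a, b ≠ a → motive (p b) → motive b) (hb : b ∈ subtree p a) :
    motive b := by
  obtain ⟨n, hn⟩ := hb
  induction n generalizing b with
  | zero =>
    obtain rfl : b = a := hn
    exact top
  | succ n ih =>
    rcases eq_or_ne b a with rfl | hne
    · exact top
    · exact step b ⟨n + 1, hn⟩ hne (ih hn)

theorem exists_parent_eq_of_mem_subtree (hb : b ∈ subtree p a) (hne : b ≠ a) :
    ∃ c, p c = a ∧ c ≠ a ∧ b ∈ subtree p c := by
  refine subtree_induction (motive := fun b => b ≠ a → ∃ c, p c = a ∧ c ≠ a ∧ b ∈ subtree p c)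
    (absurd rfl) (fun b _ hba ih _ => ?_) hb hne
  by_cases hpb : p b = a
  · exact ⟨b, hpb, hba, self_mem_subtree b⟩
  · obtain ⟨c, hc, hca, hbc⟩ := ih hpb
    exact ⟨c, hc, hca, mem_subtree_of_parent_mem hbc⟩

theorem parentGraph_adj_parent (h : p a ≠ a) : (parentGraph p).Adj (p a) a :=
  (fromRel_adj _ _ _).mpr ⟨h, Or.inr rfl⟩

theorem parent_eq_of_adj (h : (parentGraph p).Adj b c) (hb : b ∈ subtree p a)
    (hc : c ∉ subtree p a) : b = a ∧ c = p a := by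
  rcases ((fromRel_adj _ _ _).mp h).2 with rfl | rfl
  · by_contra! hne
    exact hc (parent_mem_subtree hb fun h => hne h (h ▸ rfl))
  · exact absurd (mem_subtree_of_parent_mem hb) hc

theorem connected_induce_of_parent_mem {D : Set V} (haD : a ∈ D) (hD : D ⊆ subtree p a)
    (hpar : ∀ b ∈ D, b ≠ a → p b ∈ D) : ((parentGraph p).induce D).Connected := by
  refine (connected_iff_exists_forall_reachable _).mpr ⟨⟨a, haD⟩, fun ⟨b, hbD⟩ => ?_⟩
  refine subtree_induction (motive := fun b => ∀ hb : b ∈ D,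
    ((parentGraph p).induce D).Reachable ⟨a, haD⟩ ⟨b, hb⟩) (fun _ => .rfl) ?_ (hD hbD) hbD
  intro b _ hba ih hb
  by_cases hfix : p b = b
  · simpa only [hfix] using ih (hpar b hb hba)
  · exact (ih (hpar b hb hba)).trans (Adj.reachable (parentGraph_adj_parent hfix))

namespace IsRootedTree

variable (hp : IsRootedTree p r)
include hp

theorem subtree_root : subtree p r = Set.univ := Set.eq_univ_of_forall hp.mem_subtree_root

theorem induction {motive : V → Prop} (root : motive r)
    (step : ∀ b, b ≠ r → motive (p b) → motive b) (b : V) : motive b :=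
  subtree_induction root (fun b _ => step b) (hp.mem_subtree_root b)

theorem eq_of_mem_subtree (hab : a ∈ subtree p b) (hba : b ∈ subtree p a) : a = b := by
  obtain ⟨m, rfl⟩ := hab
  obtain ⟨n, hn⟩ := hba
  rcases Nat.eq_zero_or_pos m with rfl | hm
  · rfl
  -- `a` is periodic, so it is the root to which all iterations eventually lead
  obtain ⟨k, hk⟩ := hp.mem_subtree_root a
  have hfix (j : ℕ) : p^[j] r = r := Function.iterate_fixed hp.parent_root j
  have har : a = r := by
    have hper : Function.IsPeriodicPt p (n + m) a := by
      rwa [Function.IsPeriodicPt, Function.IsFixedPt, Function.iterate_add_apply]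
    have hle : k ≤ (n + m) * k := Nat.le_mul_of_pos_left k (by omega)
    rw [← (hper.mul_const k).eq, ← Nat.sub_add_cancel hle, Function.iterate_add_apply, hk, hfix]
  rw [har, hfix]

theorem parent_notMem_subtree (ha : a ≠ r) : p a ∉ subtree p a := fun h => by
  have hfix : p a = a := hp.eq_of_mem_subtree h (mem_subtree_parent a)
  obtain ⟨n, hn⟩ := hp.mem_subtree_root a
  exact ha ((Function.iterate_fixed hfix n).symm.trans hn)

theorem parent_ne (ha : a ≠ r) : p a ≠ a := fun h =>
  hp.parent_notMem_subtree ha (h.symm ▸ self_mem_subtree a)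

theorem root_notMem_subtree (ha : a ≠ r) : r ∉ subtree p a := fun h =>
  ha (hp.eq_of_mem_subtree (hp.mem_subtree_root a) h)

theorem finite_ancestors (b : V) : {a | b ∈ subtree p a}.Finite := by
  induction b using hp.induction with
  | root =>
    exact (Set.finite_singleton r).subset fun a ha =>
      hp.eq_of_mem_subtree (hp.mem_subtree_root a) ha
  | step b _ ih =>
    refine (ih.insert b).subset fun a ha => ?_
    rcases eq_or_ne b a with rfl | hne
    · exact Set.mem_insert _ _
    · exact Set.mem_insert_of_mem _ (parent_mem_subtree ha hne)

theorem adj_iff : (parentGraph p).Adj a b ↔ b ≠ r ∧ a = p b ∨ a ≠ r ∧ b = p a := by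
  constructor
  · intro h
    obtain ⟨hne, rfl | rfl⟩ := (fromRel_adj _ _ _).mp h
    · exact Or.inr ⟨fun har => hne (har ▸ hp.parent_root.symm), rfl⟩
    · exact Or.inl ⟨fun hbr => hne (hbr ▸ hp.parent_root), rfl⟩
  · rintro (⟨hb, rfl⟩ | ⟨ha, rfl⟩)
    · exact parentGraph_adj_parent (hp.parent_ne hb)
    · exact (parentGraph_adj_parent (hp.parent_ne ha)).symm

theorem deleteEdges_adj_parent (ha : a ≠ r) (hb : b ≠ r) (hba : b ≠ a) :
    ((parentGraph p).deleteEdges {s(p a, a)}).Adj (p b) b := by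
  refine deleteEdges_adj.mpr ⟨parentGraph_adj_parent (hp.parent_ne hb), fun h => ?_⟩
  rcases Sym2.eq_iff.mp h with ⟨-, h⟩ | ⟨h, rfl⟩
  · exact hba h
  · exact hp.parent_notMem_subtree ha ⟨1, h⟩

theorem setOf_reachable_above (ha : a ≠ r) :
    {b | ((parentGraph p).deleteEdges {s(p a, a)}).Reachable a b} = subtree p a := by
  ext b
  refine ⟨fun h => mem_of_reachable (fun b hb c hbc => ?_) h (self_mem_subtree a), fun hb => ?_⟩
  · by_contra hc
    obtain ⟨hbc, hne⟩ := deleteEdges_adj.mp hbc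
    obtain ⟨rfl, rfl⟩ := parent_eq_of_adj hbc hb hc
    exact hne Sym2.eq_swap
  · refine subtree_induction (motive := Reachable _ a) .rfl (fun b hb hba ih => ih.trans ?_) hb
    exact (hp.deleteEdges_adj_parent ha (fun hbr => hp.root_notMem_subtree ha (hbr ▸ hb))
      hba).reachable

theorem setOf_reachable_below (ha : a ≠ r) :
    {b | ((parentGraph p).deleteEdges {s(p a, a)}).Reachable (p a) b} = (subtree p a)ᶜ := by
  ext b
  refine ⟨fun h => mem_of_reachable (fun b hb c hbc hc => ?_) h (hp.parent_notMem_subtree ha),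
    fun hb => ?_⟩
  · obtain ⟨hbc, hne⟩ := deleteEdges_adj.mp hbc
    obtain ⟨rfl, rfl⟩ := parent_eq_of_adj hbc.symm hc hb
    exact hne rfl
  · have hroot (b : V) : b ∉ subtree p a →
        ((parentGraph p).deleteEdges {s(p a, a)}).Reachable r b := by
      induction b using hp.induction with
      | root => exact fun _ => .rfl
      | step b hbr ih =>
        intro hb
        exact (ih fun h => hb (mem_subtree_of_parent_mem h)).trans (hp.deleteEdges_adj_parent ha hbr
          fun hba => hb (hba ▸ self_mem_subtree b)).reachable
    exact (hroot _ (hp.parent_notMem_subtree ha)).symm.trans (hroot b hb)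

theorem isTree : (parentGraph p).IsTree := by
  refine ⟨?_, isAcyclic_iff_forall_adj_isBridge.mpr fun a b hab => ?_⟩
  · exact (induceUnivIso _).connected_iff.mp (connected_induce_of_parent_mem (Set.mem_univ r)
      hp.subtree_root.ge fun _ _ _ => Set.mem_univ _)
  · wlog h : b ≠ r ∧ a = p b generalizing a b
    · rw [Sym2.eq_swap]
      exact this _ _ hab.symm ((hp.adj_iff.mp hab).resolve_left h)
    obtain ⟨hb, rfl⟩ := h
    refine isBridge_iff.mpr fun hreach => ?_
    have hmem : b ∈ (subtree p b)ᶜ := hp.setOf_reachable_below hb ▸ hreach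
    exact hmem (self_mem_subtree b)

theorem parent_mem_support (ha : a ≠ r) (q : (parentGraph p).Walk r a) : p a ∈ q.support := by
  obtain ⟨d, hd, hfst, hsnd⟩ := q.exists_boundary_dart (subtree p a)ᶜ
    (hp.root_notMem_subtree ha) (not_not.mpr (self_mem_subtree a))
  rw [← (parent_eq_of_adj d.adj.symm (not_not.mp hsnd) hfst).2]
  exact q.dart_fst_mem_support_of_mem_darts hd

end IsRootedTree

theorem mem_of_mem_support_of_isAcyclic {T : SimpleGraph V} (hT : T.IsAcyclic) {S : Set V}
    (hS : (T.induce S).Connected) (ha : a ∈ S) (hb : b ∈ S) {q : T.Walk a b} (hq : q.IsPath)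
    (hc : c ∈ q.support) : c ∈ S := by
  obtain ⟨q', hq'⟩ := (hS.preconnected ⟨a, ha⟩ ⟨b, hb⟩).exists_isPath
  have hinj : Function.Injective (Embedding.induce (G := T) S).toHom := Subtype.val_injective
  obtain rfl : q = q'.map (Embedding.induce S).toHom := congrArg Subtype.val
    ((hT.subsingleton_path a b).elim ⟨q, hq⟩ ⟨_, hq'.map hinj⟩)
  obtain ⟨c, -, rfl⟩ := List.mem_map.mp
    ((Walk.support_map (Embedding.induce S).toHom q').symm ▸ hc)
  exact c.2

end RootedTree

/-! ### Normal trees -/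

/-- `p` is the parent function of a normal tree order of `G` with root `r`: adjacent vertices of
`G` are comparable, and every subtree above a vertex induces a connected subgraph of `G`. The root
is exempt from the latter so that `G` need not be connected. -/
structure IsNormalTree {V : Type u} (G : SimpleGraph V) (p : V → V) (r : V) : Prop
    extends IsRootedTree p r where
  comparable : ∀ v w, G.Adj v w → v ∈ subtree p w ∨ w ∈ subtree p v
  connected : ∀ v ≠ r, (G.induce (subtree p v)).Connected

section Gluing

variable {V : Type u} {G : SimpleGraph V} {r : V} {C : G.ComponentCompl {r}}
  {P : ∀ C : G.ComponentCompl {r}, ↥(C : Set V) → ↥(C : Set V)}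
  {s : ∀ C : G.ComponentCompl {r}, ↥(C : Set V)} {ρ : Ordinal.{u}}

open Classical in
/-- The parent function that arises from parent functions `P C` on the components `C` of `G - r`
by joining their roots `s C` to `r`. -/
noncomputable def glue (P : ∀ C : G.ComponentCompl {r}, ↥(C : Set V) → ↥(C : Set V))
    (s : ∀ C : G.ComponentCompl {r}, ↥(C : Set V)) (v : V) : V :=
  if h : v ∈ ({r} : Set V) then r
  else if s (G.componentComplMk h) = v then r
  else P (G.componentComplMk h) ⟨v, G.componentComplMk_mem h⟩

open Classical in
theorem glue_coe (x : (C : Set V)) : glue P s x = if (s C : V) = x then r else ↑(P C x) := by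
  obtain ⟨v, h, rfl⟩ := x
  exact dif_neg h

theorem glue_root : glue P s r = r := dif_pos (Set.mem_singleton r)

theorem glue_top : glue P s (s C) = r := (glue_coe _).trans (if_pos rfl)

theorem glue_of_ne {x : (C : Set V)} (hx : x ≠ s C) : glue P s x = P C x :=
  (glue_coe x).trans (if_neg fun h => hx (Subtype.ext h.symm))

theorem ne_of_mem_componentCompl {v : V} (hv : v ∈ C) : v ≠ r := fun h =>
  ComponentCompl.notMem_of_mem hv h

theorem exists_coe_eq_of_ne_root {v : V} (hv : v ≠ r) :
    ∃ (C : G.ComponentCompl {r}) (x : (C : Set V)), v = x :=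
  ⟨G.componentComplMk hv, ⟨v, G.componentComplMk_mem (K := {r}) hv⟩, rfl⟩

theorem exists_parent_eq_of_glue_mem {v : V} (hv : glue P s v ∈ C) :
    ∃ x : (C : Set V), v = x ∧ glue P s v = P C x := by
  have hvr : v ≠ r := by
    rintro rfl
    exact ComponentCompl.notMem_of_mem hv glue_root
  obtain ⟨C', x, rfl⟩ := exists_coe_eq_of_ne_root (G := G) hvr
  have hx : x ≠ s C' := by
    rintro rfl
    exact ComponentCompl.notMem_of_mem hv glue_top
  have hglue : glue P s x = P C' x := glue_of_ne hx
  obtain rfl := componentCompl_eq_of_mem hv (hglue ▸ (P C' x).2)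
  exact ⟨x, rfl, hglue⟩

theorem subtree_glue (hP : IsRootedTree (P C) (s C)) (x : (C : Set V)) :
    subtree (glue P s) x = (↑) '' subtree (P C) x := by
  apply Set.Subset.antisymm
  · intro b hb
    refine subtree_induction (motive := (· ∈ (↑) '' subtree (P C) x))
      ⟨x, self_mem_subtree x, rfl⟩ ?_ hb
    rintro b - - ⟨y, hy, hyb⟩
    obtain ⟨b, rfl, hb⟩ := exists_parent_eq_of_glue_mem (hyb ▸ y.2 : glue P s b ∈ C)
    obtain rfl : y = P C b := Subtype.ext (hyb.trans hb)
    exact ⟨b, mem_subtree_of_parent_mem hy, rfl⟩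
  · rintro _ ⟨y, hy, rfl⟩
    refine subtree_induction (motive := fun y : (C : Set V) => (y : V) ∈ subtree (glue P s) x)
      (self_mem_subtree _) (fun y hy hyx ih => mem_subtree_of_parent_mem ?_) hy
    have hys : y ≠ s C := by
      rintro rfl
      exact hyx (hP.eq_of_mem_subtree hy (hP.mem_subtree_root x))
    rwa [glue_of_ne hys]

theorem subtree_glue_top (hP : IsRootedTree (P C) (s C)) :
    subtree (glue P s) (s C) = (C : Set V) := by
  rw [subtree_glue hP, hP.subtree_root, Set.image_univ, Subtype.range_coe]

theorem isRootedTree_glue (hP : ∀ C, IsRootedTree (P C) (s C)) : IsRootedTree (glue P s) r where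
  parent_root := glue_root
  mem_subtree_root v := by
    by_cases hv : v = r
    · rw [hv]
      exact self_mem_subtree r
    obtain ⟨C, x, rfl⟩ := exists_coe_eq_of_ne_root (G := G) hv
    have htop : glue P s (s C) ∈ subtree (glue P s) r := by
      rw [glue_top]
      exact self_mem_subtree r
    exact subtree_subset (mem_subtree_of_parent_mem htop) ((subtree_glue_top (hP C)).ge x.2)

theorem isNormalTree_glue
    (hP : ∀ C : G.ComponentCompl {r}, IsNormalTree (G.induce (C : Set V)) (P C) (s C)) :
    IsNormalTree G (glue P s) r where
  toIsRootedTree := isRootedTree_glue fun C => (hP C).toIsRootedTree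
  comparable v w hvw := by
    have hroot := (isRootedTree_glue fun C => (hP C).toIsRootedTree).mem_subtree_root
    by_cases hv : v = r
    · exact Or.inr (hv ▸ hroot w)
    by_cases hw : w = r
    · exact Or.inl (hw ▸ hroot v)
    obtain ⟨C, x, rfl⟩ := exists_coe_eq_of_ne_root (G := G) hv
    lift w to (C : Set V) using ComponentCompl.mem_of_adj _ _ x.2 hw hvw
    rw [subtree_glue (hP C).toIsRootedTree, subtree_glue (hP C).toIsRootedTree]
    exact ((hP C).comparable x w hvw).imp (Set.mem_image_of_mem _) (Set.mem_image_of_mem _)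
  connected v hv := by
    obtain ⟨C, x, rfl⟩ := exists_coe_eq_of_ne_root (G := G) hv
    by_cases hx : x = s C
    · rw [hx, subtree_glue_top (hP C).toIsRootedTree]
      exact connected_induce_componentCompl C
    · rw [subtree_glue (hP C).toIsRootedTree]
      exact connected_induce_image (Embedding.induce (C : Set V)).toHom ((hP C).connected x hx)

theorem rankLE_parentGraph_glue {F : Set (G.ComponentCompl {r})} (hF : F.Finite)
    (hrank : ∀ C, RankLE ρ (parentGraph (P C)))
    (hlt : ∀ C ∉ F, ∃ β < ρ, RankLE β (parentGraph (P C))) :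
    RankLE ρ (parentGraph (glue P s)) := by
  have hadj {a b : V} (ha : a ≠ r) (hb : b ≠ r) (hab : (parentGraph (glue P s)).Adj a b) :
      ∃ (C : G.ComponentCompl {r}) (x y : (C : Set V)), a = x ∧ b = y ∧
        (parentGraph (P C)).Adj x y := by
    wlog h : glue P s a = b generalizing a b
    · obtain ⟨C, y, x, rfl, rfl, hyx⟩ := this hb ha hab.symm
        (((fromRel_adj _ _ _).mp hab).2.resolve_left h)
      exact ⟨C, x, y, rfl, rfl, hyx.symm⟩
    obtain ⟨C, y, rfl⟩ := exists_coe_eq_of_ne_root (G := G) hb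
    obtain ⟨x, rfl, hx⟩ := exists_parent_eq_of_glue_mem (h ▸ y.2 : glue P s a ∈ C)
    exact ⟨C, x, y, rfl, rfl, (fromRel_adj _ _ _).mpr
      ⟨fun hxy => hab.ne (congrArg _ hxy), Or.inl (Subtype.ext (hx.symm.trans h))⟩⟩
  have hinduce (C : G.ComponentCompl {r}) {β} (h : RankLE β (parentGraph (P C))) :
      RankLE β ((parentGraph (glue P s)).induce (C : Set V)) := by
    refine h.of_hom ⟨id, fun {a b} hab => ?_⟩ Function.injective_id
    obtain ⟨C', x, y, hax, hby, hxy⟩ := hadj (ne_of_mem_componentCompl a.2)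
      (ne_of_mem_componentCompl b.2) hab
    obtain rfl := componentCompl_eq_of_mem a.2 (hax ▸ x.2)
    obtain rfl := Subtype.ext hax
    obtain rfl := Subtype.ext hby
    exact hxy
  refine .of_cover (Set.finite_singleton r) (fun C : G.ComponentCompl {r} => (C : Set V))
    (fun v hv => ⟨_, G.componentComplMk_mem hv⟩) ?_ hF (fun C _ => hinduce C (hrank C))
    fun C hC => (hlt C hC).imp fun β hβ => ⟨hβ.1, hinduce C hβ.2⟩
  intro C a ha b hb hab
  obtain ⟨C', x, y, rfl, rfl, -⟩ := hadj (ne_of_mem_componentCompl ha) hb hab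
  obtain rfl := componentCompl_eq_of_mem ha x.2
  exact y.2

end Gluing

section Existence

variable {V : Type u} {G : SimpleGraph V} {ρ : Ordinal.{u}} {X : Set V}

theorem Reduces.induce_componentCompl (h : Reduces ρ G X) {Y : Set V} (C : G.ComponentCompl Y) :
    Reduces ρ (G.induce (C : Set V)) {x | (x : V) ∈ X} :=
  ⟨h.1.preimage Subtype.val_injective.injOn, fun K =>
    h.exists_lt_rankLE (connected_induce_componentCompl K)
      ((Embedding.induce (C : Set V)).toHom.comp (Embedding.induce (K : Set (C : Set V))).toHom)
      (Subtype.val_injective.comp Subtype.val_injective)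
      fun w hw => ComponentCompl.notMem_of_mem w.2 hw⟩

/-- A normal tree is built by taking as its root an element of a reducing set `X`; the components
of the rest have smaller rank, except for finitely many that have a smaller reducing set. -/
theorem exists_isNormalTree [Nonempty V] (h : RankLE ρ G) :
    ∃ p r, IsNormalTree G p r ∧ RankLE ρ (parentGraph p) := by
  induction ρ using WellFoundedLT.induction generalizing V with
  | ind ρ ihρ =>
  obtain ⟨X, hX⟩ := rankLE_iff_exists_reduces.mp h
  clear h
  induction hn : X.ncard using Nat.strong_induction_on generalizing V with
  | _ n ihn =>
  obtain ⟨r, hr⟩ : ∃ r, X.Nonempty → r ∈ X := by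
    rcases X.eq_empty_or_nonempty with rfl | ⟨r, hr⟩
    · exact ⟨Classical.arbitrary V, fun h => absurd h Set.not_nonempty_empty⟩
    · exact ⟨r, fun _ => hr⟩
  have hcomp (C : G.ComponentCompl {r}) : ∃ P s, IsNormalTree (G.induce (C : Set V)) P s ∧
      RankLE ρ (parentGraph P) ∧
      (C ∉ {C : G.ComponentCompl {r} | ((C : Set V) ∩ X).Nonempty} →
        ∃ β < ρ, RankLE β (parentGraph P)) := by
    have := C.nonempty.to_subtype
    by_cases hCX : ((C : Set V) ∩ X).Nonempty
    · have hlt : {x : (C : Set V) | (x : V) ∈ X}.ncard < n := by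
        rw [← hn, ← Set.ncard_image_of_injective _ Subtype.val_injective]
        refine Set.ncard_lt_ncard ⟨?_, fun hsub => ?_⟩ hX.1
        · rintro _ ⟨x, hx, rfl⟩
          exact hx
        · obtain ⟨x, -, hxr⟩ := hsub (hr (hCX.mono Set.inter_subset_right))
          exact ne_of_mem_componentCompl x.2 hxr
      obtain ⟨P, s, hP, hrank⟩ := ihn _ hlt _ (hX.induce_componentCompl C) rfl
      exact ⟨P, s, hP, hrank, fun h => absurd hCX h⟩
    · obtain ⟨β, hβ, hrank⟩ := hX.exists_lt_rankLE (connected_induce_componentCompl C)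
        (Embedding.induce (C : Set V)).toHom Subtype.val_injective fun w hw => hCX ⟨w, w.2, hw⟩
      obtain ⟨P, s, hP, hrank⟩ := ihρ β hβ hrank
      exact ⟨P, s, hP, hrank.mono hβ.le, fun _ => ⟨β, hβ, hrank⟩⟩
  choose P s hP hrank hlt using hcomp
  exact ⟨glue P s, r, isNormalTree_glue hP,
    rankLE_parentGraph_glue (finite_componentCompl_meeting hX.1) hrank hlt⟩

end Existence

/-! ### Down-neighbourhoods in normal trees -/

section DownNbhd

variable {V : Type u} {G : SimpleGraph V} {p : V → V} {r k l v x : V} {Y : Set V}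

/-- The neighbourhood in `G` of the subtree above `v`, which in a normal tree lies below `v`. -/
abbrev downNbhd (G : SimpleGraph V) (p : V → V) (v : V) : Set V := nbhd G (subtree p v)

namespace IsNormalTree

variable (hp : IsNormalTree G p r)
include hp

theorem mem_subtree_of_mem_downNbhd (hx : x ∈ downNbhd G p v) : v ∈ subtree p x := by
  obtain ⟨hxv, w, hw, hwx⟩ := hx
  rcases hp.comparable w x hwx with h | h
  · exact (mem_subtree_total hw h).resolve_right hxv
  · exact absurd (subtree_subset hw h) hxv

theorem parent_mem_subtree_of_mem_downNbhd (hx : x ∈ downNbhd G p v) : p v ∈ subtree p x :=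
  parent_mem_subtree (hp.mem_subtree_of_mem_downNbhd hx) fun h => hx.1 (h ▸ self_mem_subtree v)

theorem finite_downNbhd (v : V) : (downNbhd G p v).Finite :=
  (hp.finite_ancestors v).subset fun _ => hp.mem_subtree_of_mem_downNbhd

theorem downNbhd_subset (v : V) : downNbhd G p v ⊆ insert (p v) (downNbhd G p (p v)) := by
  intro x hx
  refine or_iff_not_imp_left.mpr fun hne => ⟨fun hxp => hne ?_, ?_⟩
  · exact hp.eq_of_mem_subtree hxp (hp.parent_mem_subtree_of_mem_downNbhd hx)
  · obtain ⟨-, w, hw, hwx⟩ := hx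
    exact ⟨w, subtree_subset (mem_subtree_parent v) hw, hwx⟩

theorem parent_mem_downNbhd (hv : v ≠ r) (hpv : p v ≠ r) : p v ∈ downNbhd G p v := by
  by_contra hmem
  have hsub : subtree p (p v) ⊆ subtree p v := by
    refine subset_of_connected_induce (hp.connected _ hpv)
      ⟨v, mem_subtree_parent v, self_mem_subtree v⟩ fun a ha b hb hab => ?_
    by_contra hbv
    have hbN : b ∈ downNbhd G p v := ⟨hbv, a, ha.2, hab⟩
    exact hmem (hp.eq_of_mem_subtree hb (hp.parent_mem_subtree_of_mem_downNbhd hbN) ▸ hbN)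
  exact hp.parent_notMem_subtree hv (hsub (self_mem_subtree _))

theorem parent_eq_of_downNbhd_eq (hk : k ≠ r) (hl : l ≠ r)
    (hkl : downNbhd G p k = downNbhd G p l) : p k = p l := by
  have habove {k l : V} (hk : k ≠ r) (hkl : downNbhd G p k = downNbhd G p l) :
      p l ∈ subtree p (p k) := by
    by_cases hpk : p k = r
    · exact hpk ▸ hp.mem_subtree_root _
    · exact hp.parent_mem_subtree_of_mem_downNbhd (hkl ▸ hp.parent_mem_downNbhd hk hpk)
  exact hp.eq_of_mem_subtree (habove hl hkl.symm) (habove hk hkl)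

theorem exists_coe_eq_subtree (hk : k ≠ r) (hkY : downNbhd G p k = Y) :
    ∃ C : G.ComponentCompl Y, (C : Set V) = subtree p k := by
  subst hkY
  exact exists_componentCompl_nbhd (hp.connected k hk)

theorem subtree_injective : Function.Injective (subtree p) := fun a b hab =>
  hp.eq_of_mem_subtree (hab ▸ self_mem_subtree a) (hab ▸ self_mem_subtree b)

/-- The exceptional components are those that contain the root or a vertex below `Y`. Any other
one has a lowest vertex `k`, and since nothing in it lies below `Y`, it is the subtree above `k`. -/
theorem finite_componentCompl_ne_subtree (hY : Y.Finite) :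
    {C : G.ComponentCompl Y | ¬ ∃ k ≠ r, (C : Set V) = subtree p k}.Finite := by
  refine (finite_componentCompl_meeting
    ((hY.biUnion fun y _ => hp.finite_ancestors y).insert r)).subset fun C hC => ?_
  by_contra hmeet
  have havoid {v} (hv : v ∈ C) : v ≠ r ∧ ∀ y ∈ Y, y ∉ subtree p v := by
    refine ⟨fun h => hmeet ⟨v, hv, Or.inl h⟩, fun y hy hyv => hmeet ⟨v, hv, Or.inr ?_⟩⟩
    exact Set.mem_biUnion hy hyv
  have hup {v} (hv : v ∈ C) : subtree p v ⊆ C :=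
    subset_of_connected_induce (hp.connected v (havoid hv).1) ⟨v, self_mem_subtree v, hv⟩
      fun a ha b hb hab => ComponentCompl.mem_of_adj a b ha.2 (fun h => (havoid hv).2 b h hb) hab
  obtain ⟨k, hk, hpk⟩ : ∃ k ∈ C, p k ∉ C := by
    by_contra! hclosed
    obtain ⟨v, hv⟩ := C.nonempty
    obtain ⟨n, hn⟩ := hp.mem_subtree_root v
    have hiter : p^[n] v ∈ C := Set.MapsTo.iterate (s := (C : Set V)) (f := p) hclosed n hv
    exact (havoid hiter).1 hn
  refine hC ⟨k, (havoid hk).1, (subset_of_connected_induce (connected_induce_componentCompl C)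
    ⟨k, hk, self_mem_subtree k⟩ fun a ha b hb hab => ?_).antisymm (hup hk)⟩
  by_contra hbk
  exact hpk (hup hb (hp.parent_mem_subtree_of_mem_downNbhd ⟨hbk, a, ha.2, hab⟩))

theorem mem_crit_iff (hY : Y.Finite) :
    Y ∈ crit G ↔ {k | k ≠ r ∧ downNbhd G p k = Y}.Infinite := by
  constructor
  · intro hcrit hfin
    refine hcrit.2 (((hfin.image (subtree p)).preimage SetLike.coe_injective.injOn).union
      (hp.finite_componentCompl_ne_subtree hY) |>.subset fun C hC => ?_)
    refine or_iff_not_imp_right.mpr fun hne => ?_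
    obtain ⟨k, hk, hCk⟩ := not_not.mp hne
    exact ⟨k, ⟨hk, (congrArg (nbhd G) hCk.symm).trans hC⟩, hCk.symm⟩
  · refine fun hinf => ⟨hY, fun hfin => hinf ?_⟩
    refine ((hfin.image SetLike.coe).preimage hp.subtree_injective.injOn).subset fun k hk => ?_
    obtain ⟨C, hC⟩ := hp.exists_coe_eq_subtree hk.1 hk.2
    exact ⟨C, (congrArg (nbhd G) hC).trans hk.2, hC⟩

theorem exists_downNbhd_eq (hY : Y ∈ crit G) : ∃ k ≠ r, downNbhd G p k = Y :=
  ((hp.mem_crit_iff hY.1).mp hY).nonempty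

end IsNormalTree
end DownNbhd

/-! ### The decomposition tree -/

section Decomposition

variable {V : Type u} {G : SimpleGraph V} {p : V → V} {r k v w x : V}

/-- The adhesion set of a node `a`: for `a ≠ root` it is the set in which the part at `a` meets
the part at its parent. -/
def adhesion (G : SimpleGraph V) (p : V → V) : V ⊕ crit G → Set V :=
  Sum.elim (downNbhd G p) Subtype.val

/-- The part at a node of the decomposition tree. -/
def bag (G : SimpleGraph V) (p : V → V) : V ⊕ crit G → Set V :=
  Sum.elim (fun v => insert v (downNbhd G p v)) Subtype.val

theorem adhesion_subset_bag (a : V ⊕ crit G) : adhesion G p a ⊆ bag G p a := by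
  rcases a with v | Y
  · exact Set.subset_insert _ _
  · exact subset_rfl

theorem mem_adhesion_of_mem_bag {a : V ⊕ crit G} (hv : v ∈ bag G p a) (hne : a ≠ Sum.inl v) :
    v ∈ adhesion G p a := by
  rcases a with w | Y
  · exact hv.resolve_left fun h => hne (h ▸ rfl)
  · exact hv

namespace IsNormalTree

variable (hp : IsNormalTree G p r)

/-- The common parent of the vertices of the normal tree whose down-neighbourhood is `Y`. -/
noncomputable def apex (Y : crit G) : V := p (hp.exists_downNbhd_eq Y.2).choose

open Classical in
/-- The parent function of the decomposition tree. Its nodes are the vertices of the normal tree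
and the critical vertex sets; every critical vertex set `Y` is inserted on the edges that lead from
its apex up to the vertices with down-neighbourhood `Y`. -/
noncomputable def nodeParent : V ⊕ crit G → V ⊕ crit G
  | Sum.inl v => if h : v ≠ r ∧ downNbhd G p v ∈ crit G then Sum.inr ⟨_, h.2⟩ else Sum.inl (p v)
  | Sum.inr Y => Sum.inl (hp.apex Y)

/-- Contracting the decomposition tree to the normal tree. -/
noncomputable def nodeVertex : V ⊕ crit G → V := Sum.elim id hp.apex

/-- The vertices of the normal tree at or above a node. -/
def core (a : V ⊕ crit G) : Set V := {v | Sum.inl v ∈ subtree hp.nodeParent a}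

variable {Y : crit G} {a : V ⊕ crit G}
include hp

theorem apex_eq (hk : k ≠ r) (hkY : downNbhd G p k = Y) : hp.apex Y = p k := by
  obtain ⟨hl, hlY⟩ := (hp.exists_downNbhd_eq Y.2).choose_spec
  exact hp.parent_eq_of_downNbhd_eq hl hk (hlY.trans hkY.symm)

theorem nodeParent_inl_eq_inr_iff :
    hp.nodeParent (Sum.inl v) = Sum.inr Y ↔ v ≠ r ∧ downNbhd G p v = Y := by
  rw [nodeParent]
  split_ifs with h
  · rw [Sum.inr.injEq, Subtype.ext_iff]
    exact (and_iff_right h.1).symm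
  · exact iff_of_false not_false fun ⟨hv, hY⟩ => h ⟨hv, hY ▸ Y.2⟩

theorem exists_of_nodeParent_eq_inr (h : hp.nodeParent a = Sum.inr Y) :
    ∃ k ≠ r, downNbhd G p k = Y ∧ a = Sum.inl k := by
  rcases a with k | Z
  · obtain ⟨hk, hkY⟩ := hp.nodeParent_inl_eq_inr_iff.mp h
    exact ⟨k, hk, hkY, rfl⟩
  · exact absurd h Sum.inl_ne_inr

theorem nodeParent_inl_eq_inl (h : hp.nodeParent (Sum.inl v) = Sum.inl w) :
    w = p v ∧ (v = r ∨ downNbhd G p v ∉ crit G) := by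
  rw [nodeParent] at h
  split_ifs at h with hcrit
  exact ⟨Sum.inl_injective h.symm, not_and_or.mp hcrit |>.imp_left not_not.mp⟩

theorem nodeVertex_nodeParent (a : V ⊕ crit G) :
    hp.nodeVertex (hp.nodeParent a) = hp.nodeVertex a ∨
      hp.nodeVertex (hp.nodeParent a) = p (hp.nodeVertex a) := by
  rcases a with v | Y
  · refine Or.inr ?_
    rcases h : hp.nodeParent (Sum.inl v) with w | Y
    · exact (hp.nodeParent_inl_eq_inl h).1
    · obtain ⟨hv, hvY⟩ := hp.nodeParent_inl_eq_inr_iff.mp h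
      exact hp.apex_eq hv hvY
  · exact Or.inl rfl

theorem inl_mem_subtree_inl_parent (v : V) :
    Sum.inl v ∈ subtree hp.nodeParent (Sum.inl (p v) : V ⊕ crit G) := by
  refine mem_subtree_of_parent_mem ?_
  rcases h : hp.nodeParent (Sum.inl v) with w | Y
  · obtain ⟨rfl, -⟩ := hp.nodeParent_inl_eq_inl h
    exact self_mem_subtree _
  · obtain ⟨hv, hvY⟩ := hp.nodeParent_inl_eq_inr_iff.mp h
    exact hp.apex_eq hv hvY ▸ mem_subtree_parent (p := hp.nodeParent) (Sum.inr Y)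

theorem inl_mem_subtree_inl (hw : w ∈ subtree p v) :
    Sum.inl w ∈ subtree hp.nodeParent (Sum.inl v : V ⊕ crit G) :=
  subtree_induction (motive := fun w => Sum.inl w ∈ subtree hp.nodeParent (Sum.inl v : V ⊕ crit G))
    (self_mem_subtree _) (fun w _ _ ih => subtree_subset ih (hp.inl_mem_subtree_inl_parent w)) hw

theorem nodeVertex_mem_subtree (ha : a ∈ subtree hp.nodeParent (Sum.inl v)) :
    hp.nodeVertex a ∈ subtree p v := by
  refine subtree_induction (motive := fun a => hp.nodeVertex a ∈ subtree p v)
    (self_mem_subtree v) (fun a _ _ ih => ?_) ha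
  rcases hp.nodeVertex_nodeParent a with h | h
  · exact h ▸ ih
  · exact mem_subtree_of_parent_mem (h ▸ ih)

theorem isRootedTree_nodeParent : IsRootedTree hp.nodeParent (Sum.inl r) where
  parent_root := by
    rw [nodeParent, dif_neg fun h => h.1 rfl, hp.parent_root]
  mem_subtree_root := by
    rintro (v | Y)
    · exact hp.inl_mem_subtree_inl (hp.mem_subtree_root v)
    · exact mem_subtree_of_parent_mem (hp.inl_mem_subtree_inl (hp.mem_subtree_root _))

theorem core_inl (v : V) : hp.core (Sum.inl v) = subtree p v :=
  Set.ext fun _ => ⟨hp.nodeVertex_mem_subtree, hp.inl_mem_subtree_inl⟩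

theorem mem_core_inr :
    v ∈ hp.core (Sum.inr Y) ↔ ∃ k ≠ r, downNbhd G p k = Y ∧ v ∈ subtree p k := by
  constructor
  · intro hv
    obtain ⟨c, hc, -, hvc⟩ := exists_parent_eq_of_mem_subtree hv Sum.inl_ne_inr
    obtain ⟨k, hk, hkY, rfl⟩ := hp.exists_of_nodeParent_eq_inr hc
    exact ⟨k, hk, hkY, hp.nodeVertex_mem_subtree hvc⟩
  · rintro ⟨k, hk, hkY, hv⟩
    have hparent := hp.nodeParent_inl_eq_inr_iff.mpr ⟨hk, hkY⟩
    exact subtree_subset (hparent ▸ mem_subtree_parent _) (hp.inl_mem_subtree_inl hv)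

theorem exists_subtree_of_mem_core (ha : a ≠ Sum.inl r) (hv : v ∈ hp.core a) :
    ∃ k ≠ r, downNbhd G p k = adhesion G p a ∧ v ∈ subtree p k ∧ subtree p k ⊆ hp.core a := by
  rcases a with k | Y
  · rw [core_inl] at hv ⊢
    exact ⟨k, fun hk => ha (hk ▸ rfl), rfl, hv, subset_rfl⟩
  · obtain ⟨k, hk, hkY, hvk⟩ := hp.mem_core_inr.mp hv
    exact ⟨k, hk, hkY, hvk, fun w hw => hp.mem_core_inr.mpr ⟨k, hk, hkY, hw⟩⟩

theorem finite_bag (a : V ⊕ crit G) : (bag G p a).Finite := by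
  rcases a with v | Y
  · exact (hp.finite_downNbhd v).insert v
  · exact Y.2.1

theorem adhesion_subset_bag_nodeParent (a : V ⊕ crit G) :
    adhesion G p a ⊆ bag G p (hp.nodeParent a) := by
  rcases a with v | Y
  · rcases h : hp.nodeParent (Sum.inl v) with w | Y
    · obtain ⟨rfl, -⟩ := hp.nodeParent_inl_eq_inl h
      exact hp.downNbhd_subset v
    · exact (hp.nodeParent_inl_eq_inr_iff.mp h).2.subset
  · obtain ⟨k, hk, hkY⟩ := hp.exists_downNbhd_eq Y.2
    rw [nodeParent, hp.apex_eq hk hkY]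
    exact hkY.symm.subset.trans (hp.downNbhd_subset k)

theorem mem_subtree_of_mem_bag (hv : v ∈ bag G p a) :
    a ∈ subtree hp.nodeParent (Sum.inl v) := by
  rcases a with w | Y
  · rcases hv with rfl | hv
    · exact self_mem_subtree _
    · exact hp.inl_mem_subtree_inl (hp.mem_subtree_of_mem_downNbhd hv)
  · obtain ⟨k, hk, hkY⟩ := hp.exists_downNbhd_eq Y.2
    refine mem_subtree_of_parent_mem (hp.inl_mem_subtree_inl ?_)
    rw [hp.apex_eq hk hkY]
    exact hp.parent_mem_subtree_of_mem_downNbhd (hkY ▸ hv)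

theorem connected_induce_setOf_mem_bag (v : V) :
    ((parentGraph hp.nodeParent).induce {a : V ⊕ crit G | v ∈ bag G p a}).Connected :=
  connected_induce_of_parent_mem (a := Sum.inl v) (Set.mem_insert v _)
    (fun _ => hp.mem_subtree_of_mem_bag) fun a ha hne =>
    hp.adhesion_subset_bag_nodeParent a (mem_adhesion_of_mem_bag ha hne)

theorem exists_bag_of_adj (hvw : G.Adj v w) :
    ∃ a : V ⊕ crit G, v ∈ bag G p a ∧ w ∈ bag G p a := by
  wlog h : w ∈ subtree p v generalizing v w
  · obtain ⟨a, hw, hv⟩ := this hvw.symm ((hp.comparable v w hvw).resolve_right h)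
    exact ⟨a, hv, hw⟩
  refine ⟨Sum.inl w, Or.inr ⟨fun hv => hvw.ne (hp.eq_of_mem_subtree hv h), w,
    self_mem_subtree w, hvw.symm⟩, Set.mem_insert w _⟩

/-- The tree-decomposition of `G` whose tree is obtained from the normal tree by inserting the
critical vertex sets. -/
noncomputable def treeDecomposition : TreeDecomposition G (V ⊕ crit G) where
  tree := parentGraph hp.nodeParent
  isTree := hp.isRootedTree_nodeParent.isTree
  part := bag G p
  vertex_mem v := ⟨Sum.inl v, Set.mem_insert v _⟩
  edge_mem _ _ := hp.exists_bag_of_adj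
  inter_subset _ _ _ _ hq ht := fun v hv => mem_of_mem_support_of_isAcyclic
    hp.isRootedTree_nodeParent.isTree.isAcyclic (hp.connected_induce_setOf_mem_bag v) hv.1 hv.2
    hq ht

theorem iUnion_bag_above (a : V ⊕ crit G) :
    ⋃ b ∈ subtree hp.nodeParent a, bag G p b = adhesion G p a ∪ hp.core a := by
  refine (Set.iUnion₂_subset fun b hb => ?_).antisymm (Set.union_subset ?_ fun v hv => ?_)
  · refine subtree_induction (motive := fun b => bag G p b ⊆ adhesion G p a ∪ hp.core a)
      (fun v hv => ?_) (fun b hb _ ih v hv => ?_) hb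
    · rcases eq_or_ne a (Sum.inl v) with rfl | hne
      · exact Or.inr (self_mem_subtree _)
      · exact Or.inl (mem_adhesion_of_mem_bag hv hne)
    · rcases eq_or_ne b (Sum.inl v) with rfl | hne
      · exact Or.inr hb
      · exact ih (hp.adhesion_subset_bag_nodeParent b (mem_adhesion_of_mem_bag hv hne))
  · exact fun v hv => Set.mem_biUnion (self_mem_subtree a) (adhesion_subset_bag a hv)
  · exact Set.mem_biUnion hv (Set.mem_insert v _)

theorem iUnion_bag_below (a : V ⊕ crit G) :
    ⋃ b ∈ (subtree hp.nodeParent a)ᶜ, bag G p b = (hp.core a)ᶜ := by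
  refine (Set.iUnion₂_subset fun b hb v hv => ?_).antisymm fun v hv => ?_
  · exact fun hva => hb (subtree_subset hva (hp.mem_subtree_of_mem_bag hv))
  · exact Set.mem_biUnion (x := Sum.inl v) (t := bag G p) hv (Set.mem_insert v _)

theorem sep_nodeParent (ha : a ≠ Sum.inl r) : hp.treeDecomposition.sep (hp.nodeParent a) a =
    ((hp.core a)ᶜ, adhesion G p a ∪ hp.core a) := by
  have habove : hp.treeDecomposition.side a (hp.nodeParent a) = subtree hp.nodeParent a := by
    rw [← hp.isRootedTree_nodeParent.setOf_reachable_above ha, Sym2.eq_swap]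
    rfl
  have hbelow : hp.treeDecomposition.side (hp.nodeParent a) a = (subtree hp.nodeParent a)ᶜ :=
    hp.isRootedTree_nodeParent.setOf_reachable_below ha
  rw [TreeDecomposition.sep, habove, hbelow, ← iUnion_bag_below, ← iUnion_bag_above]
  rfl

theorem finite_setOf_nodeVertex_eq (v : V) : {a | hp.nodeVertex a = v}.Finite := by
  have hfin : {Y : crit G | (Y : Set V) ⊆ bag G p (Sum.inl v : V ⊕ crit G)}.Finite :=
    (hp.finite_bag _).finite_subsets.preimage Subtype.val_injective.injOn
  refine ((hfin.image Sum.inr).insert (Sum.inl v)).subset ?_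
  rintro (w | Y) rfl
  · exact Or.inl rfl
  · exact Or.inr ⟨Y, hp.adhesion_subset_bag_nodeParent (Sum.inr Y), rfl⟩

variable {ρ : Ordinal.{u}}

theorem rankLE_tree (h : RankLE ρ (parentGraph p)) : RankLE ρ hp.treeDecomposition.tree := by
  refine h.of_finite_parts (fun v => {a | hp.nodeVertex a = v}) hp.finite_setOf_nodeVertex_eq
    (fun a => connected_induce_setOf_eq _) ?_
  suffices hparent : ∀ a, hp.nodeVertex (hp.nodeParent a) = hp.nodeVertex a ∨
      (parentGraph p).Adj (hp.nodeVertex (hp.nodeParent a)) (hp.nodeVertex a) by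
    intro a b hab
    refine ⟨_, _, rfl, rfl, ?_⟩
    rcases hp.isRootedTree_nodeParent.adj_iff.mp hab with ⟨-, rfl⟩ | ⟨-, rfl⟩
    · exact hparent b
    · exact (hparent a).imp Eq.symm Adj.symm
  intro a
  refine or_iff_not_imp_left.mpr fun hne => ?_
  have heq := (hp.nodeVertex_nodeParent a).resolve_left hne
  rw [heq] at hne ⊢
  exact parentGraph_adj_parent hne

theorem rankLE_of_tree (h : RankLE ρ hp.treeDecomposition.tree) : RankLE ρ G := by
  refine h.of_finite_parts (bag G p) hp.finite_bag hp.connected_induce_setOf_mem_bag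
    fun v w hvw => ?_
  obtain ⟨a, hv, hw⟩ := hp.exists_bag_of_adj hvw
  exact ⟨a, a, hv, hw, Or.inl rfl⟩

end IsNormalTree
end Decomposition

/-! ### Displaying the combinatorial remainder -/

section Separations

variable {V : Type u} {G : SimpleGraph V} {X : Set V}

theorem compsUnion_compl (𝒞 : Set (G.ComponentCompl X)) :
    compsUnion 𝒞ᶜ = (X ∪ compsUnion 𝒞)ᶜ := by
  refine (Set.iUnion₂_subset fun C hC v hv => ?_).antisymm fun v hv => ?_
  · rintro (hvX | hvU)
    · exact ComponentCompl.notMem_of_mem hv hvX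
    · obtain ⟨C', hC', hv'⟩ := Set.mem_iUnion₂.mp hvU
      exact hC (componentCompl_eq_of_mem hv hv' ▸ hC')
  · obtain ⟨hvX, hvU⟩ := not_or.mp hv
    exact Set.mem_biUnion (x := G.componentComplMk hvX)
      (fun hC => hvU (Set.mem_biUnion hC (G.componentComplMk_mem hvX))) (G.componentComplMk_mem hvX)

theorem swap_orientedSep (𝒞 : Set (G.ComponentCompl X)) :
    (orientedSep X 𝒞).swap = orientedSep X 𝒞ᶜ := by
  have hcompl := compsUnion_compl 𝒞ᶜ
  rw [compl_compl] at hcompl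
  rw [orientedSep, orientedSep, Prod.swap_prod_mk, compsUnion_compl, compl_compl,
    ← compsUnion_compl, hcompl, compl_compl]

theorem IsTameSep.swap {P : Set V × Set V} (h : IsTameSep G P) : IsTameSep G P.swap := by
  obtain ⟨X, 𝒞, hX, rfl, htame⟩ := h
  refine ⟨X, 𝒞ᶜ, hX, swap_orientedSep 𝒞, fun Y hY => ?_⟩
  rw [compl_compl, and_comm]
  exact htame Y hY

/-- Almost all of the infinitely many components in question lie in both sides. -/
theorem OrientsTowards.infinite_inter {Y : crit G} {P Q : Set V × Set V}
    (hP : OrientsTowards (Sum.inr Y) P) (hQ : OrientsTowards (Sum.inr Y) Q) :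
    (P.2 ∩ Q.2).Infinite := by
  intro hfin
  refine Y.2.2 (((hP.2.union hQ.2).union (finite_componentCompl_meeting hfin)).subset
    fun C hC => ?_)
  by_cases hCP : (C : Set V) ⊆ P.2
  · by_cases hCQ : (C : Set V) ⊆ Q.2
    · obtain ⟨v, hv⟩ := C.nonempty
      exact Or.inr ⟨v, hv, hCP hv, hCQ hv⟩
    · exact Or.inl (Or.inr ⟨hC, hCQ⟩)
  · exact Or.inl (Or.inl ⟨hC, hCP⟩)

theorem swap_orientedSep_singleton (C : G.ComponentCompl X) :
    (orientedSep X {C}).swap = (X ∪ C, (C : Set V)ᶜ) := by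
  rw [orientedSep, compsUnion, Set.biUnion_singleton]
  rfl

theorem IsRayless.isEmpty_graphEnd (hG : IsRayless G) : IsEmpty (GraphEnd G) :=
  ⟨Quotient.ind hG.false⟩

end Separations

section Display

variable {V : Type u} {G : SimpleGraph V} {p : V → V} {r k v : V} {Y : crit G} {a b : V ⊕ crit G}

namespace IsNormalTree

variable (hp : IsNormalTree G p r)

/-- The components of `G - adhesion a` above the node `a`: they are the set `𝒞` for which the edge
from the parent of `a` to `a` induces the separation `(adhesion a, 𝒞)`. -/
def coreComps (a : V ⊕ crit G) : Set (G.ComponentCompl (adhesion G p a)) :=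
  {C | (C : Set V) ⊆ hp.core a}

/-- `coreComps` at the node of a critical vertex set `Y`, as components of `G - Y`. -/
def critComps (Y : crit G) : Set (G.ComponentCompl (Y : Set V)) := hp.coreComps (Sum.inr Y)

include hp

theorem finite_adhesion (a : V ⊕ crit G) : (adhesion G p a).Finite :=
  (hp.finite_bag a).subset (adhesion_subset_bag a)

theorem exists_coe_eq_subtree_of_mem_coreComps (ha : a ≠ Sum.inl r)
    {C : G.ComponentCompl (adhesion G p a)} (hC : C ∈ hp.coreComps a) :
    ∃ k ≠ r, downNbhd G p k = adhesion G p a ∧ (C : Set V) = subtree p k := by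
  obtain ⟨v, hv⟩ := C.nonempty
  obtain ⟨k, hk, hka, hvk, -⟩ := hp.exists_subtree_of_mem_core ha (hC hv)
  obtain ⟨C', hC'⟩ := hp.exists_coe_eq_subtree hk hka
  obtain rfl : C = C' := componentCompl_eq_of_mem hv (hC' ▸ hvk : v ∈ (C' : Set V))
  exact ⟨k, hk, hka, hC'⟩

theorem compsUnion_coreComps (ha : a ≠ Sum.inl r) : compsUnion (hp.coreComps a) = hp.core a := by
  refine Set.Subset.antisymm (Set.iUnion₂_subset fun _ hC => hC) fun v hv => ?_
  obtain ⟨k, hk, hka, hvk, hsub⟩ := hp.exists_subtree_of_mem_core ha hv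
  obtain ⟨C, hC⟩ := hp.exists_coe_eq_subtree hk hka
  rw [← hC] at hvk hsub
  exact Set.mem_biUnion hsub hvk

theorem sep_nodeParent_eq_orientedSep (ha : a ≠ Sum.inl r) :
    hp.treeDecomposition.sep (hp.nodeParent a) a =
      orientedSep (adhesion G p a) (hp.coreComps a) := by
  rw [hp.sep_nodeParent ha, orientedSep, hp.compsUnion_coreComps ha]

theorem mem_critComps {C : G.ComponentCompl (Y : Set V)} :
    C ∈ hp.critComps Y ↔ ∃ k ≠ r, downNbhd G p k = Y ∧ (C : Set V) = subtree p k := by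
  refine ⟨hp.exists_coe_eq_subtree_of_mem_coreComps Sum.inr_ne_inl, ?_⟩
  rintro ⟨k, hk, hkY, hCk⟩ v hv
  exact hp.mem_core_inr.mpr ⟨k, hk, hkY, hCk ▸ hv⟩

theorem sep_nodeParent_inr (Y : crit G) :
    hp.treeDecomposition.sep (hp.nodeParent (Sum.inr Y)) (Sum.inr Y) =
      orientedSep (Y : Set V) (hp.critComps Y) :=
  hp.sep_nodeParent_eq_orientedSep Sum.inr_ne_inl

theorem critComps_subset (Y : crit G) : hp.critComps Y ⊆ compsWithNbhd G (Y : Set V) Y := by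
  intro C hC
  obtain ⟨k, -, hkY, hCk⟩ := hp.mem_critComps.mp hC
  exact (congrArg (nbhd G) hCk).trans hkY

theorem finite_coreComps_inl (hv : v ≠ r) : (hp.coreComps (Sum.inl v)).Finite := by
  obtain ⟨C, hC⟩ := hp.exists_coe_eq_subtree hv rfl
  refine (Set.finite_singleton C).subset fun C' hC' => ?_
  obtain ⟨w, hw⟩ := C'.nonempty
  refine componentCompl_eq_of_mem hw (?_ : w ∈ (C : Set V))
  rw [hC, ← hp.core_inl]
  exact hC' hw

theorem finite_compsWithNbhd_diff_critComps (Y : crit G) :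
    (compsWithNbhd G (Y : Set V) Y \ hp.critComps Y).Finite := by
  refine (hp.finite_componentCompl_ne_subtree Y.2.1).subset fun C hC => ?_
  rintro ⟨k, hk, hCk⟩
  exact hC.2 (hp.mem_critComps.mpr ⟨k, hk, (congrArg (nbhd G) hCk).symm.trans hC.1, hCk⟩)

theorem isTameSep_nodeParent (ha : a ≠ Sum.inl r) :
    IsTameSep G (hp.treeDecomposition.sep (hp.nodeParent a) a) := by
  refine ⟨adhesion G p a, hp.coreComps a, hp.finite_adhesion a,
    hp.sep_nodeParent_eq_orientedSep ha, ?_⟩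
  rintro Z - ⟨hinf, hinf'⟩
  obtain ⟨C, hC, rfl⟩ := hinf.nonempty
  rcases a with v | Y
  · exact hinf ((hp.finite_coreComps_inl fun hv => ha (hv ▸ rfl)).inter_of_left _)
  · have hCY : nbhd G (C : Set V) = Y := hp.critComps_subset Y hC
    exact hinf' ((hp.finite_compsWithNbhd_diff_critComps Y).subset fun C' hC' =>
      ⟨hC'.2.trans hCY, hC'.1⟩)

theorem isTame_treeDecomposition : hp.treeDecomposition.IsTame := by
  intro s t hst
  rcases hp.isRootedTree_nodeParent.adj_iff.mp hst with ⟨ht, rfl⟩ | ⟨hs, rfl⟩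
  · exact hp.isTameSep_nodeParent ht
  · exact (hp.isTameSep_nodeParent hs).swap

theorem sep_to_nodeParent (ha : a ≠ Sum.inl r) : hp.treeDecomposition.sep a (hp.nodeParent a) =
    (adhesion G p a ∪ hp.core a, (hp.core a)ᶜ) :=
  congrArg Prod.swap (hp.sep_nodeParent ha)

theorem sep_inl_inr (hk : k ≠ r) (hkY : downNbhd G p k = Y) :
    hp.treeDecomposition.sep (Sum.inl k) (Sum.inr Y) =
      ((Y : Set V) ∪ subtree p k, (subtree p k)ᶜ) := by
  rw [← hp.nodeParent_inl_eq_inr_iff.mpr ⟨hk, hkY⟩,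
    hp.sep_to_nodeParent (Sum.inl_injective.ne hk), core_inl, ← hkY]
  rfl

theorem neighborSet_inr (Y : crit G) : hp.treeDecomposition.tree.neighborSet (Sum.inr Y) =
    insert (hp.nodeParent (Sum.inr Y)) (Sum.inl '' {k | k ≠ r ∧ downNbhd G p k = Y}) := by
  ext s
  refine (adj_comm _ _ _).trans <| hp.isRootedTree_nodeParent.adj_iff.trans
    (or_congr (and_iff_right Sum.inr_ne_inl) ⟨?_, ?_⟩)
  · rintro ⟨-, hsY⟩
    obtain ⟨k, hk, hkY, rfl⟩ := hp.exists_of_nodeParent_eq_inr hsY.symm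
    exact ⟨k, ⟨hk, hkY⟩, rfl⟩
  · rintro ⟨k, hk, rfl⟩
    exact ⟨Sum.inl_injective.ne hk.1, (hp.nodeParent_inl_eq_inr_iff.mpr hk).symm⟩

theorem infinite_neighborSet_inr (Y : crit G) :
    (hp.treeDecomposition.tree.neighborSet (Sum.inr Y)).Infinite := by
  rw [neighborSet_inr]
  exact (((hp.mem_crit_iff Y.2.1).mp Y.2).image Sum.inl_injective.injOn).mono
    (Set.subset_insert _ _)

theorem finite_setOf_downNbhd_subset {Z : Set V} (hZ : Z.Finite) :
    {k | k ≠ r ∧ downNbhd G p k ⊆ Z ∧ downNbhd G p k ∉ crit G}.Finite := by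
  have hfiber (X : Set V) (hX : X ⊆ Z ∧ X ∉ crit G) : {k | k ≠ r ∧ downNbhd G p k = X}.Finite :=
    Set.not_infinite.mp fun hinf => hX.2 ((hp.mem_crit_iff (hZ.subset hX.1)).mpr hinf)
  refine ((hZ.finite_subsets.subset fun X hX => hX.1).biUnion hfiber).subset fun k hk => ?_
  exact Set.mem_biUnion hk.2 ⟨hk.1, rfl⟩

theorem finite_neighborSet_inl (v : V) :
    (hp.treeDecomposition.tree.neighborSet (Sum.inl v)).Finite := by
  refine (((hp.finite_setOf_nodeVertex_eq v).union ((hp.finite_setOf_downNbhd_subset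
    (hp.finite_bag (Sum.inl v))).image Sum.inl)).insert (hp.nodeParent (Sum.inl v))).subset
    fun s hs => ?_
  rcases hp.isRootedTree_nodeParent.adj_iff.mp hs with ⟨hsr, hsv⟩ | ⟨-, rfl⟩
  · rcases s with k | Y
    · obtain ⟨-, hk⟩ := hp.nodeParent_inl_eq_inl hsv.symm
      have hkr : k ≠ r := fun h => hsr (h ▸ rfl)
      exact Or.inr (Or.inr ⟨k, ⟨hkr, hsv ▸ hp.adhesion_subset_bag_nodeParent (Sum.inl k),
        hk.resolve_left hkr⟩, rfl⟩)
    · exact Or.inr (Or.inl (Sum.inl_injective hsv).symm)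
  · exact Or.inl rfl

theorem setOf_infinite_neighborSet :
    {t | (hp.treeDecomposition.tree.neighborSet t).Infinite} = Set.range Sum.inr := by
  ext (v | Y)
  · exact iff_of_false (not_not.mpr (hp.finite_neighborSet_inl v)) fun ⟨_, h⟩ => Sum.inr_ne_inl h
  · exact iff_of_true (hp.infinite_neighborSet_inr Y) ⟨Y, rfl⟩

theorem livesAt_inr (Y : crit G) : hp.treeDecomposition.LivesAt (Sum.inr Y) (Sum.inr Y) := by
  intro s hs
  rw [adj_comm, ← mem_neighborSet, neighborSet_inr] at hs
  rcases hs with rfl | ⟨k, ⟨hk, hkY⟩, rfl⟩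
  · rw [hp.sep_nodeParent Sum.inr_ne_inl]
    refine ⟨Set.subset_union_left, (hp.finite_compsWithNbhd_diff_critComps Y).subset ?_⟩
    exact fun C hC => ⟨hC.1, fun hCY => hC.2 (hCY.trans Set.subset_union_right)⟩
  · rw [hp.sep_inl_inr hk hkY]
    obtain ⟨C, hC⟩ := hp.exists_coe_eq_subtree hk hkY
    refine ⟨fun y hy => (hkY ▸ hy : y ∈ downNbhd G p k).1, (Set.finite_singleton C).subset ?_⟩
    rintro C' ⟨-, hC'⟩
    obtain ⟨v, hv, hvk⟩ := Set.not_subset.mp hC'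
    exact componentCompl_eq_of_mem hv (hC ▸ not_not.mp hvk : v ∈ (C : Set V))

theorem eq_of_livesAt_of_mem_subtree (ha : hp.treeDecomposition.LivesAt (Sum.inr Y) a)
    (hb : hp.treeDecomposition.LivesAt (Sum.inr Y) b) (hba : b ∈ subtree hp.nodeParent a) :
    b = a := by
  have hq := hp.isRootedTree_nodeParent
  by_contra hne
  obtain ⟨c, rfl, hc, hbc⟩ := exists_parent_eq_of_mem_subtree hba hne
  have hcr : c ≠ Sum.inl r := fun h => hc (h ▸ hq.parent_root.symm)
  have hbr : b ≠ Sum.inl r := fun h => hq.root_notMem_subtree hcr (h ▸ hbc)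
  have hbelow := ha c (parentGraph_adj_parent (hq.parent_ne hcr)).symm
  have habove := hb _ (parentGraph_adj_parent (hq.parent_ne hbr))
  rw [hp.sep_to_nodeParent hcr] at hbelow
  rw [hp.sep_nodeParent hbr] at habove
  refine hbelow.infinite_inter habove ((hp.finite_adhesion b).subset ?_)
  rintro v ⟨hvc, hvb⟩
  exact hvb.resolve_right fun hv => hvc (subtree_subset hbc hv)

theorem eq_of_livesAt (ha : hp.treeDecomposition.LivesAt (Sum.inr Y) a)
    (hb : hp.treeDecomposition.LivesAt (Sum.inr Y) b) : a = b := by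
  have hq := hp.isRootedTree_nodeParent
  by_cases hab : a ∈ subtree hp.nodeParent b
  · exact hp.eq_of_livesAt_of_mem_subtree hb ha hab
  by_cases hba : b ∈ subtree hp.nodeParent a
  · exact (hp.eq_of_livesAt_of_mem_subtree ha hb hba).symm
  have har : a ≠ Sum.inl r := fun h => hba (h ▸ hq.mem_subtree_root b)
  have hbr : b ≠ Sum.inl r := fun h => hab (h ▸ hq.mem_subtree_root a)
  have haboveA := ha _ (parentGraph_adj_parent (hq.parent_ne har))
  have haboveB := hb _ (parentGraph_adj_parent (hq.parent_ne hbr))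
  rw [hp.sep_nodeParent har] at haboveA
  rw [hp.sep_nodeParent hbr] at haboveB
  refine absurd (((hp.finite_adhesion a).union (hp.finite_adhesion b)).subset ?_)
    (haboveA.infinite_inter haboveB)
  rintro v ⟨hva | hva, hvb | hvb⟩
  · exact Or.inl hva
  · exact Or.inl hva
  · exact Or.inr hvb
  · exact absurd (mem_subtree_total hva hvb) (not_or.mpr ⟨hab, hba⟩)

theorem image_sep_children (Y : crit G) :
    (fun s => hp.treeDecomposition.sep s (Sum.inr Y)) ''
        (Sum.inl '' {k | k ≠ r ∧ downNbhd G p k = Y}) =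
      {P | ∃ C ∈ hp.critComps Y, P = (orientedSep (Y : Set V) {C}).swap} := by
  ext P
  constructor
  · rintro ⟨-, ⟨k, ⟨hk, hkY⟩, rfl⟩, rfl⟩
    obtain ⟨C, hC⟩ := hp.exists_coe_eq_subtree hk hkY
    refine ⟨C, hp.mem_critComps.mpr ⟨k, hk, hkY, hC⟩, ?_⟩
    rw [swap_orientedSep_singleton, hC]
    exact hp.sep_inl_inr hk hkY
  · rintro ⟨C, hC, rfl⟩
    obtain ⟨k, hk, hkY, hCk⟩ := hp.mem_critComps.mp hC
    refine ⟨_, ⟨k, ⟨hk, hkY⟩, rfl⟩, ?_⟩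
    rw [swap_orientedSep_singleton, hCk]
    exact hp.sep_inl_inr hk hkY

theorem injOn_sep_inr (Y : crit G) :
    Set.InjOn (fun s => hp.treeDecomposition.sep s (Sum.inr Y))
      (hp.treeDecomposition.tree.neighborSet (Sum.inr Y)) := by
  have hne : ∀ k, k ≠ r ∧ downNbhd G p k = Y →
      hp.treeDecomposition.sep (hp.nodeParent (Sum.inr Y)) (Sum.inr Y) ≠
        hp.treeDecomposition.sep (Sum.inl k) (Sum.inr Y) := by
    rintro k ⟨hk, hkY⟩ h
    rw [hp.sep_nodeParent Sum.inr_ne_inl, hp.sep_inl_inr hk hkY] at h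
    have hkcore : k ∈ hp.core (Sum.inr Y) :=
      hp.mem_core_inr.mpr ⟨k, hk, hkY, self_mem_subtree k⟩
    exact (Set.ext_iff.mp (congrArg Prod.snd h) k).mp (Or.inr hkcore) (self_mem_subtree k)
  rw [neighborSet_inr]
  rintro - (rfl | ⟨k, hk, rfl⟩) - (rfl | ⟨l, hl, rfl⟩) h
  · rfl
  · exact absurd h (hne l hl)
  · exact absurd h.symm (hne k hk)
  · dsimp only at h
    rw [hp.sep_inl_inr hk.1 hk.2, hp.sep_inl_inr hl.1 hl.2] at h
    exact congrArg _ (hp.subtree_injective (compl_injective (congrArg Prod.snd h)))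

theorem bijOn_sep (Y : crit G) :
    Set.BijOn (fun s => hp.treeDecomposition.sep s (Sum.inr Y))
      (hp.treeDecomposition.tree.neighborSet (Sum.inr Y))
      (insert (orientedSep (Y : Set V) (hp.critComps Y))
        {P | ∃ C ∈ hp.critComps Y, P = (orientedSep (Y : Set V) {C}).swap}) := by
  have himage := (hp.injOn_sep_inr Y).bijOn_image
  rwa [neighborSet_inr, Set.image_insert_eq, hp.image_sep_children,
    hp.sep_nodeParent_inr, ← neighborSet_inr] at himage

theorem displays (hG : IsRayless G) (hT : IsRayless hp.treeDecomposition.tree) :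
    hp.treeDecomposition.Displays (Sum.inl r) Set.univ := by
  have := hG.isEmpty_graphEnd
  have := hT.isEmpty_graphEnd
  refine ⟨Sum.elim isEmptyElim (Sum.inr ∘ Sum.inr), ?_, ?_, ?_, ?_, fun γ hγ => absurd trivial hγ⟩
  · rintro (ω | Y)
    · exact isEmptyElim ω
    refine ⟨isEmptyElim, fun t => Sum.inr_injective.eq_iff.trans ⟨?_, ?_⟩⟩
    · rintro rfl
      exact hp.livesAt_inr Y
    · exact hp.eq_of_livesAt (hp.livesAt_inr Y)
  · rw [Set.range_eq_empty, Set.range_eq_empty, Set.inter_empty]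
    exact Set.bijOn_empty _
  · rw [setOf_infinite_neighborSet, Set.univ_inter, ← Set.range_comp]
    refine ⟨Set.forall_mem_range.mpr Set.mem_range_self, ?_, ?_⟩
    · rintro - ⟨Y, rfl⟩ - ⟨Z, rfl⟩ h
      exact congrArg _ (Sum.inr_injective (Sum.inr_injective h))
    · rintro - ⟨Y, rfl⟩
      exact ⟨_, Set.mem_range_self Y, rfl⟩
  · rintro Y t - ht
    obtain rfl : Sum.inr Y = t := Sum.inr_injective ht
    refine ⟨_, hp.critComps Y, ⟨?_, fun q _ => ?_⟩,
      hp.sep_nodeParent_inr Y, hp.critComps_subset Y,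
      hp.finite_compsWithNbhd_diff_critComps Y, hp.bijOn_sep Y⟩
    · exact parentGraph_adj_parent (hp.isRootedTree_nodeParent.parent_ne Sum.inr_ne_inl)
    · exact hp.isRootedTree_nodeParent.parent_mem_support Sum.inr_ne_inl q

end IsNormalTree
end Display

end InfGraph

theorem corollary3p12_general {V : Type u} [Nonempty V] (G : SimpleGraph V) :
    (InfGraph.IsRayless G ↔ ∃ ρ : Ordinal.{u}, InfGraph.HasRank ρ G) ∧
    (InfGraph.IsRayless G →
      ∃ (W : Type u) (D : InfGraph.TreeDecomposition G W) (r : W),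
        D.IsTame ∧
        (∀ t, (D.part t).Finite) ∧
        D.Displays r Set.univ ∧
        ∃ ρ : Ordinal.{u}, InfGraph.HasRank ρ G ∧ InfGraph.HasRank ρ D.tree) := by
  refine ⟨⟨fun hG => ?_, fun ⟨ρ, hρ⟩ => InfGraph.RankLE.isRayless ⟨ρ, le_rfl, hρ⟩⟩, fun hG => ?_⟩
  · obtain ⟨-, ρ, -, hρ⟩ := InfGraph.exists_rankLE_of_isRayless hG
    exact ⟨ρ, hρ⟩
  · obtain ⟨-, ρ, -, hρ⟩ := InfGraph.exists_rankLE_of_isRayless hG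
    obtain ⟨p, r, hp, hpρ⟩ := InfGraph.exists_isNormalTree ⟨ρ, le_rfl, hρ⟩
    obtain ⟨τ, hτρ, hτ⟩ := hp.rankLE_tree hpρ
    obtain ⟨σ, hστ, hσ⟩ := hp.rankLE_of_tree ⟨τ, le_rfl, hτ⟩
    obtain rfl : ρ = τ := ((hρ.le hσ).trans hστ).antisymm hτρ
    exact ⟨_, hp.treeDecomposition, Sum.inl r, hp.isTame_treeDecomposition, hp.finite_bag,
      hp.displays hG (InfGraph.RankLE.isRayless ⟨ρ, le_rfl, hτ⟩), ρ, hρ, hτ⟩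

theorem corollary3p12 {V : Type u} (G : SimpleGraph V) (hG : G.Connected) :
    (InfGraph.IsRayless G ↔ ∃ ρ : Ordinal.{u}, InfGraph.HasRank ρ G) ∧
    (InfGraph.IsRayless G →
      ∃ (W : Type u) (D : InfGraph.TreeDecomposition G W) (r : W),
        D.IsTame ∧
        (∀ t, (D.part t).Finite) ∧
        D.Displays r Set.univ ∧
        ∃ ρ : Ordinal.{u}, InfGraph.HasRank ρ G ∧ InfGraph.HasRank ρ D.tree) := by
  have := hG.nonempty
  exact corollary3p12_general G
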